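/- Let $1\le m<n$, let $1<p<\infty$, let $\omega_1\subset\mathbb R^m$ be open, bounded and convex with $0\in\omega_1$, and let $\omega_2\subset\mathbb R^{n-m}$ be open and bounded. Write $x=(X_1,X_2)\in\mathbb R^m\times\mathbb R^{n-m}$ and $\Omega_\ell=\ell\omega_1\times\omega_2$ for $\ell>0$. Let $H:\mathbb R^n\to[0,\infty)$ be convex, positive away from $0$, of class $C^1$ on $\mathbb R^n\setminus\{0\}$, with $H(tz)=|t|H(z)$ for all $t\in\mathbb R$, $z\in\mathbb R^n$. Put $A(z)=H^{p-1}(z)\nabla H(z)$ for $z\neq0$ and $A(0)=0$, and let $A_2$ denote the last $n-m$ components of $A$. Consider the following conditions. (A1) If $p\ge2$, there is $c_1>0$ with $\langle A(z_1)-A(z_2),z_1-z_2\rangle\ge c_1|z_1-z_2|^p$ for all $z_1,z_2\in\mathbb R^n$. If $1<p<2$, there is $c_2>0$ with $\langle A(z_1)-A(z_2),z_1-z_2\rangle\ge c_2|z_1-z_2|^2(|z_1|+|z_2|)^{p-2}$ for all $z_1,z_2\in\mathbb R^n$ not both zero. (A2) If $1<p<2$, there is $c_3>0$ with $|A(z_1)-A(z_2)|\le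 c_3|z_1-z_2|(|z_1|+|z_2|)^{p-2}$ for all $z_1,z_2\in\mathbb R^n$ not both zero. Let $f\in L^{p/(p-1)}(\omega_2)$. For $\ell>0$ let $u_\ell\in W^{1,p}_0(\Omega_\ell)$ be the weak solution of $-\operatorname{div}A(\nabla u_\ell)=f(X_2)$ in $\Omega_\ell$, that is, $$\int_{\Omega_\ell}\langle A(\nabla u_\ell),\nabla\varphi\rangle\,dx=\int_{\Omega_\ell}f(X_2)\varphi\,dx\qquad\text{for all }\varphi\in W^{1,p}_0(\Omega_\ell),$$ and let $u_\infty\in W^{1,p}_0(\omega_2)$ be the weak solution on the cross-section, that is, $$\int_{\omega_2}\langle A_2(0,\nabla u_\infty),\nabla\varphi\rangle\,dX_2=\int_{\omega_2}f\varphi\,dX_2\qquad\text{for all }\varphi\in W^{1,p}_0(\omega_2).$$ Extend $u_\infty$ to $\Omega_\ell$ constantly with respect to $X_1$. (i) If $p\ge2$ and (A1) holds, then there is a constant $C_1>0$, independent of $\ell$, such that for all $\ell>0$ $$\|\nabla(u_\ell-u_\infty)\|_{L^p(\Omega_{\ell/2})}^p\le C_1\,\ell^{\,m-\frac{p}{p-1}}.$$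 (ii) If $1<p<2$ and (A1) and (A2) hold, then there is a constant $C_2>0$, independent of $\ell$, such that for all $\ell>0$ $$\|\nabla(u_\ell-u_\infty)\|_{L^p(\Omega_{\ell/2})}^p\le C_2\,\ell^{\,m-\frac{p^2}{2-p}}.$$ -/

import Mathlib

open MeasureTheory Filter Topology Set
open scoped ContDiff Pointwise ENNReal RealInnerProductSpace

noncomputable section

section Sobolev

variable {E : Type*} [NormedAddCommGroup E] [InnerProductSpace ℝ E] [FiniteDimensional ℝ E]
  [MeasurableSpace E] [BorelSpace E]

/-- The test functions on `Ω`: smooth functions with compact support contained in `Ω`. -/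
def IsTestFunction (Ω : Set E) (φ : E → ℝ) : Prop :=
  ContDiff ℝ ∞ φ ∧ HasCompactSupport φ ∧ tsupport φ ⊆ Ω

/-- `g` is the weak (distributional) gradient of `u` on the open set `Ω`. It is determined by `u`
almost everywhere on `Ω`. -/
def HasWeakGradient (Ω : Set E) (u : E → ℝ) (g : E → E) : Prop :=
  LocallyIntegrableOn u Ω ∧ LocallyIntegrableOn g Ω ∧
    ∀ φ : E → ℝ, IsTestFunction Ω φ →
      ∫ x in Ω, u x • gradient φ x = - ∫ x in Ω, φ x • g x

/-- `u` belongs to the Sobolev space `W^{1,p}(Ω)` and `g` is its weak gradient. -/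
def MemW1p (p : ℝ) (Ω : Set E) (u : E → ℝ) (g : E → E) : Prop :=
  HasWeakGradient Ω u g ∧ MemLp u (ENNReal.ofReal p) (volume.restrict Ω) ∧
    MemLp g (ENNReal.ofReal p) (volume.restrict Ω)

/-- `u` belongs to `W₀^{1,p}(Ω)`, the closure of the test functions in `W^{1,p}(Ω)`, and `g` is
its weak gradient. -/
def MemW01p (p : ℝ) (Ω : Set E) (u : E → ℝ) (g : E → E) : Prop :=
  MemW1p p Ω u g ∧ ∃ φ : ℕ → E → ℝ, (∀ j, IsTestFunction Ω (φ j)) ∧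
    Tendsto (fun j => eLpNorm (fun x => φ j x - u x) (ENNReal.ofReal p) (volume.restrict Ω))
      atTop (𝓝 0) ∧
    Tendsto (fun j => eLpNorm (fun x => gradient (φ j) x - g x) (ENNReal.ofReal p)
      (volume.restrict Ω)) atTop (𝓝 0)

/-- `u` is a weak solution of `-div (A (∇u)) = f` in `Ω`, `u ∈ W₀^{1,p}(Ω)`. -/
def IsWeakSolution (p : ℝ) (A : E → E) (Ω : Set E) (f u : E → ℝ) : Prop :=
  ∃ g : E → E, MemW01p p Ω u g ∧
    ∀ (φ : E → ℝ) (γ : E → E), MemW01p p Ω φ γ →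
      ∫ x in Ω, ⟪A (g x), γ x⟫ = ∫ x in Ω, f x * φ x

end Sobolev

section Finsler

variable {E : Type*} [NormedAddCommGroup E] [InnerProductSpace ℝ E] [FiniteDimensional ℝ E]

/-- The standing assumptions on the anisotropy `H`. -/
structure IsAnisotropy (H : E → ℝ) : Prop where
  nonneg : ∀ x, 0 ≤ H x
  pos : ∀ x, x ≠ 0 → 0 < H x
  convex : ConvexOn ℝ univ H
  homogeneous : ∀ (t : ℝ) (x : E), H (t • x) = |t| * H x
  contDiffOn : ContDiffOn ℝ 1 H {0}ᶜ

/-- The vector field `z ↦ H(z)^{p-1} ∇H(z)`. At `z = 0`, where `H` is not differentiable, it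
vanishes for `p > 1`, because `H 0 = 0`. -/
def finslerFlux (p : ℝ) (H : E → ℝ) (z : E) : E :=
  (H z ^ (p - 1)) • gradient H z

/-- The monotonicity condition on `H` for `p ≥ 2`. -/
def MonotoneFluxGe (p : ℝ) (H : E → ℝ) : Prop :=
  ∃ c₁ : ℝ, 0 < c₁ ∧ ∀ z₁ z₂ : E,
    c₁ * ‖z₁ - z₂‖ ^ p ≤ ⟪finslerFlux p H z₁ - finslerFlux p H z₂, z₁ - z₂⟫

/-- The monotonicity condition on `H` for `1 < p < 2`. For `z₁ = z₂ = 0` both sides are zero. -/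
def MonotoneFluxLt (p : ℝ) (H : E → ℝ) : Prop :=
  ∃ c₂ : ℝ, 0 < c₂ ∧ ∀ z₁ z₂ : E,
    c₂ * ‖z₁ - z₂‖ ^ 2 * (‖z₁‖ + ‖z₂‖) ^ (p - 2) ≤
      ⟪finslerFlux p H z₁ - finslerFlux p H z₂, z₁ - z₂⟫

/-- The Lipschitz type condition on `H` for `1 < p < 2`. -/
def LipschitzFlux (p : ℝ) (H : E → ℝ) : Prop :=
  ∃ c₃ : ℝ, 0 < c₃ ∧ ∀ z₁ z₂ : E,
    ‖finslerFlux p H z₁ - finslerFlux p H z₂‖ ≤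
      c₃ * ‖z₁ - z₂‖ * (‖z₁‖ + ‖z₂‖) ^ (p - 2)

end Finsler

section Cylinder

/-- The Euclidean space `ℝⁿ = ℝᵐ × ℝᵏ`, `n = m + k`, whose points are `x = (X₁, X₂)` with
`X₁ = x.fst` and `X₂ = x.snd`; its inner product and volume are the Euclidean ones. -/
abbrev ProdSpace (m k : ℕ) : Type :=
  WithLp 2 (EuclideanSpace ℝ (Fin m) × EuclideanSpace ℝ (Fin k))

variable {m k : ℕ}

/-- The cylinder `Ω_ℓ = ℓ ω₁ × ω₂`. -/
def finiteCylinder (ω₁ : Set (EuclideanSpace ℝ (Fin m))) (ω₂ : Set (EuclideanSpace ℝ (Fin k)))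
    (ℓ : ℝ) : Set (ProdSpace m k) :=
  {x | x.fst ∈ ℓ • ω₁ ∧ x.snd ∈ ω₂}

/-- The vector field `ζ ↦ H(0, ζ)^{p-1} ∇_{Z₂} H(0, ζ)` of the problem on the cross-section. -/
def crossFlux (p : ℝ) (H : ProdSpace m k → ℝ) (ζ : EuclideanSpace ℝ (Fin k)) :
    EuclideanSpace ℝ (Fin k) :=
  (finslerFlux p H (WithLp.toLp 2 (0, ζ))).snd

end Cylinder

end

/-!
The two solutions are compared through the strong monotonicity of the flux `A`. Since `A (0, ∇u_∞)`
does not depend on `X₁`, the extension of `u_∞` solves the equation on the cylinder as well: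
its longitudinal part integrates to zero against gradients of test functions, and the remaining part
is the equation on the cross-section, tested with slices
(`IsTestFunction.integral_cylinder_eq`). Only the longitudinal boundary condition fails, and it is
removed by a cut-off function `η (X₁)` with `η = 1` on the half cylinder and `|∇η| ≤ K / ℓ`.

Write `w = u_ℓ - u_∞`, `G = ∇w`, `D = A (∇u_ℓ) - A (0, ∇u_∞)`. Testing the difference of the two
equations with `η ^ n w` gives (`integral_flux_sub_le`)
`∫ η ^ n ⟪D, G⟫ ≤ (n K / ℓ) ∫ ‖D‖ η ^ (n - 1) |w|`.
The Poincaré inequality in a direction of the bounded cross-section, in which `η` is constant,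
bounds the norm of `η ^ a w` by that of `η ^ a G`, with a constant that does not see `ℓ`
(`poincare_cutoff_mul_sub`).

* For `p ≥ 2` take `n = 2`. With `X = ∫ η ^ 2 ‖G‖ ^ p` and Hölder's inequality,
  `X ≤ (C / ℓ) (∫ ‖D‖ ^ (p / (p - 1))) ^ (1 - 1 / p) X ^ (1 / p)`
  (`integral_sq_mul_le_of_two_le`).
* For `1 < p < 2` take `n = 2 a` with `a ≥ p / (2 - p)`, put `S = ‖∇u_ℓ‖ + ‖∇u_∞‖`, and run the
  same argument for the energy `∫ η ^ (2 a) ‖G‖ ^ 2 S ^ (p - 2)`, from which the `L^p` norm is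
  recovered by Hölder's inequality (`integral_pow_mul_le_of_lt_two`).

In both cases the superlinear power is absorbed (`le_rpow_mul_of_le_mul_rpow`), and what remains is
a power of `C / ℓ` times `∫ S ^ p`, which is `O(ℓ ^ m)` by testing the equation on the cylinder with
its own solution (`exists_integral_add_rpow_le`).
-/

/-! ### Growth and measurability of the flux -/

section Flux

variable {E : Type*} [NormedAddCommGroup E] [InnerProductSpace ℝ E]

lemma IsAnisotropy.map_zero {H : E → ℝ} (hH : IsAnisotropy H) : H 0 = 0 := by
  simpa using hH.homogeneous 0 0

lemma IsAnisotropy.map_add_le {H : E → ℝ} (hH : IsAnisotropy H) (x y : E) :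
    H (x + y) ≤ H x + H y := by
  have h := hH.convex.2 (mem_univ ((2 : ℝ) • x)) (mem_univ ((2 : ℝ) • y))
    (by norm_num : (0 : ℝ) ≤ 1 / 2) (by norm_num : (0 : ℝ) ≤ 1 / 2) (by norm_num)
  simp only [smul_smul, hH.homogeneous, smul_eq_mul] at h
  norm_num at h
  linarith

variable [FiniteDimensional ℝ E]

lemma IsAnisotropy.continuous {H : E → ℝ} (hH : IsAnisotropy H) : Continuous H :=
  continuousOn_univ.1 (hH.convex.continuousOn isOpen_univ)

lemma IsAnisotropy.exists_le_mul_norm {H : E → ℝ} (hH : IsAnisotropy H) :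
    ∃ M : ℝ, 0 ≤ M ∧ ∀ x, H x ≤ M * ‖x‖ := by
  obtain ⟨M, hM⟩ := (isCompact_sphere (0 : E) 1).bddAbove_image hH.continuous.continuousOn
  refine ⟨max M 0, le_max_right _ _, fun x => ?_⟩
  rcases eq_or_ne x 0 with rfl | hx
  · simp [hH.map_zero]
  have hx' : 0 < ‖x‖ := norm_pos_iff.2 hx
  have h1 : H (‖x‖⁻¹ • x) ≤ M := hM ⟨_, by simp [norm_smul, hx'.ne'], rfl⟩
  rw [hH.homogeneous, abs_of_pos (inv_pos.2 hx'), inv_mul_le_iff₀ hx'] at h1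
  nlinarith [le_max_left M 0]

/-- A convex function that is positively homogeneous of degree one is subadditive, hence Lipschitz;
this bounds its gradient. -/
lemma IsAnisotropy.norm_gradient_le {H : E → ℝ} (hH : IsAnisotropy H) {M : ℝ} (hM0 : 0 ≤ M)
    (hM : ∀ x, H x ≤ M * ‖x‖) (x : E) : ‖gradient H x‖ ≤ M := by
  rw [gradient, LinearIsometryEquiv.norm_map]
  refine norm_fderiv_le_of_lip' ℝ hM0 (.of_forall fun y => ?_)
  have h1 := hH.map_add_le (y - x) x
  have h2 := hH.map_add_le (x - y) y
  have h3 := hM (y - x)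
  have h4 := hM (x - y)
  rw [norm_sub_rev] at h4
  simp only [sub_add_cancel] at h1 h2
  rw [Real.norm_eq_abs, abs_le]
  constructor <;> linarith

lemma IsAnisotropy.exists_norm_flux_le {H : E → ℝ} (hH : IsAnisotropy H) {p : ℝ} (hp : 1 < p) :
    ∃ K : ℝ, 0 ≤ K ∧ ∀ z, ‖finslerFlux p H z‖ ≤ K * ‖z‖ ^ (p - 1) := by
  obtain ⟨M, hM0, hM⟩ := hH.exists_le_mul_norm
  refine ⟨M ^ (p - 1) * M, by positivity, fun z => ?_⟩
  rw [finslerFlux, norm_smul, Real.norm_of_nonneg (Real.rpow_nonneg (hH.nonneg z) _)]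
  calc H z ^ (p - 1) * ‖gradient H z‖ ≤ (M * ‖z‖) ^ (p - 1) * M := by
        exact mul_le_mul (Real.rpow_le_rpow (hH.nonneg z) (hM z) (by linarith))
          (hH.norm_gradient_le hM0 hM z) (norm_nonneg _) (by positivity)
    _ = _ := by rw [Real.mul_rpow hM0 (norm_nonneg z)]; ring

lemma IsAnisotropy.flux_zero {H : E → ℝ} (hH : IsAnisotropy H) {p : ℝ} (hp : 1 < p) :
    finslerFlux p H 0 = 0 := by
  rw [finslerFlux, hH.map_zero, Real.zero_rpow (by linarith), zero_smul]

lemma IsAnisotropy.measurable_flux [MeasurableSpace E] [BorelSpace E] {H : E → ℝ}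
    (hH : IsAnisotropy H) (p : ℝ) : Measurable (finslerFlux p H) := by
  have h1 : Measurable (gradient H) :=
    (InnerProductSpace.toDual ℝ E).symm.continuous.measurable.comp (measurable_fderiv ℝ H)
  exact (hH.continuous.measurable.pow_const (p - 1)).smul h1

end Flux

/-! ### Absorbing a power -/

/-- Every estimate of the argument bounds a quantity by a smaller power of itself; this lemma
absorbs that power. -/
lemma le_rpow_mul_of_le_mul_rpow {X b M s : ℝ} (hX : 0 ≤ X) (hb : 0 ≤ b) (hM : 0 ≤ M)
    (hs : 0 < s) (h : X ≤ b * M ^ s * X ^ (1 - s)) : X ≤ b ^ (1 / s) * M := by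
  rcases hX.eq_or_lt with rfl | hX'
  · positivity
  have h1 : X ^ s ≤ b * M ^ s := by
    have h2 : X = X ^ s * X ^ (1 - s) := by rw [← Real.rpow_add hX']; simp
    have h3 : 0 < X ^ (1 - s) := Real.rpow_pos_of_pos hX' _
    exact le_of_mul_le_mul_right (h2.symm.trans_le h) h3
  have h2 := Real.rpow_le_rpow (by positivity) h1 (by positivity : 0 ≤ 1 / s)
  rwa [Real.mul_rpow hb (by positivity), ← Real.rpow_mul hX, ← Real.rpow_mul hM,
    mul_one_div_cancel hs.ne', Real.rpow_one, Real.rpow_one] at h2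

/-! ### Cut-off functions -/

/-- Convexity and `0 ∈ U` enter only through `closure (U / 2) ⊆ U`. -/
lemma Convex.exists_cutoff {F : Type*} [NormedAddCommGroup F] [InnerProductSpace ℝ F]
    [FiniteDimensional ℝ F] {U : Set F} (ho : IsOpen U) (hb : Bornology.IsBounded U)
    (hc : Convex ℝ U) (h0 : (0 : F) ∈ U) :
    ∃ χ : F → ℝ, ContDiff ℝ ∞ χ ∧ HasCompactSupport χ ∧ tsupport χ ⊆ U ∧
      (∀ x, χ x ∈ Icc (0 : ℝ) 1) ∧ ∀ x ∈ (2⁻¹ : ℝ) • U, χ x = 1 := by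
  have hsub : closure ((2⁻¹ : ℝ) • U) ⊆ U := by
    rw [closure_smul₀ (2⁻¹ : ℝ)]
    rintro _ ⟨y, hy, rfl⟩
    have := hc.combo_interior_closure_subset_interior (a := 2⁻¹) (b := 2⁻¹) (by norm_num)
      (by norm_num) (by norm_num) (add_mem_add (smul_mem_smul_set (a := (2⁻¹ : ℝ))
        (ho.interior_eq.symm ▸ h0)) (smul_mem_smul_set (a := (2⁻¹ : ℝ)) hy))
    rw [ho.interior_eq] at this
    simpa using this
  have hcpt : IsCompact (closure ((2⁻¹ : ℝ) • U)) := (hb.smul₀ _).isCompact_closure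
  obtain ⟨L, hL, hL1, hL2⟩ := exists_compact_between hcpt ho hsub
  obtain ⟨χ, hχ1, hχ0, hχr⟩ := exists_contMDiffMap_one_nhds_of_subset_interior
    (modelWithCornersSelf ℝ F) (n := (⊤ : ℕ∞)) (s := closure ((2⁻¹ : ℝ) • U)) (t := L)
    isClosed_closure hL1
  have hts : tsupport χ ⊆ L := closure_minimal
    (fun x hx => by_contra fun h => hx (hχ0 x h)) hL.isClosed
  exact ⟨χ, χ.contMDiff.contDiff, hL.of_isClosed_subset (isClosed_tsupport _) hts,
    hts.trans hL2, hχr, fun x hx => hχ1.self_of_nhdsSet x (subset_closure hx)⟩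

/-! ### Convergence of bilinear pairings -/

lemma memLp_of_tendsto_eLpNorm_sub {α F : Type*} [MeasurableSpace α] {μ : Measure α}
    [NormedAddCommGroup F] {P : ℝ≥0∞} {u : ℕ → α → F} {v : α → F} (hv : MemLp v P μ)
    (hu : ∀ j, AEStronglyMeasurable (u j) μ)
    (h : Tendsto (fun j => eLpNorm (fun x => u j x - v x) P μ) atTop (𝓝 0)) :
    ∀ᶠ j in atTop, MemLp (u j) P μ := by
  filter_upwards [h.eventually_lt_const ENNReal.zero_lt_top] with j hj
  have h1 : MemLp (fun x => u j x - v x) P μ := ⟨(hu j).sub hv.1, hj⟩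
  exact (h1.add hv).ae_eq (.of_forall fun x => by simp)

lemma tendsto_integral_bilin {α F G W : Type*} [MeasurableSpace α] {μ : Measure α}
    [NormedAddCommGroup F] [NormedSpace ℝ F] [NormedAddCommGroup G] [NormedSpace ℝ G]
    [NormedAddCommGroup W] [NormedSpace ℝ W] {P Q : ℝ≥0∞} [ENNReal.HolderConjugate P Q]
    (B : F →L[ℝ] G →L[ℝ] W) {u : ℕ → α → F} {v : α → F} {g : α → G} (hv : MemLp v P μ)
    (hg : MemLp g Q μ) (hu : ∀ j, AEStronglyMeasurable (u j) μ)
    (h : Tendsto (fun j => eLpNorm (fun x => u j x - v x) P μ) atTop (𝓝 0)) :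
    Tendsto (fun j => ∫ x, B (u j x) (g x) ∂μ) atTop (𝓝 (∫ x, B (v x) (g x) ∂μ)) := by
  refine tendsto_integral_of_L1' _ (B.aestronglyMeasurable_comp₂ hv.1 hg.1) ?_ ?_
  · filter_upwards [memLp_of_tendsto_eLpNorm_sub hv hu h] with j hj
    exact memLp_one_iff_integrable.1 (MemLp.of_bilin (B · ·) ‖B‖₊ hj hg
      (B.aestronglyMeasurable_comp₂ hj.1 hg.1) (.of_forall fun _ => B.le_opNorm₂ _ _))
  · have h1 : ∀ j, eLpNorm ((fun x => B (u j x) (g x)) - fun x => B (v x) (g x)) 1 μ ≤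
        ‖B‖₊ * eLpNorm (fun x => u j x - v x) P μ * eLpNorm g Q μ := fun j => by
      have := eLpNorm_le_eLpNorm_mul_eLpNorm_of_nnnorm (p := P) (q := Q) (r := 1)
        ((hu j).sub hv.1) hg.1 (B · ·) ‖B‖₊ (.of_forall fun _ => B.le_opNorm₂ _ _)
      refine le_trans (le_of_eq ?_) this
      congr 1
      ext x
      simp
    refine tendsto_of_tendsto_of_tendsto_of_le_of_le tendsto_const_nhds ?_ (fun _ => zero_le) h1
    have h2 := ENNReal.Tendsto.mul_const (ENNReal.Tendsto.const_mul (a := (‖B‖₊ : ℝ≥0∞)) h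
      (.inr ENNReal.coe_ne_top)) (.inr hg.2.ne) (b := eLpNorm g Q μ)
    simpa using h2

/-! ### Strong approximation by smooth functions -/

section Sobolev

variable {E : Type*} [NormedAddCommGroup E] [InnerProductSpace ℝ E]

lemma IsTestFunction.eq_zero {Ω : Set E} {φ : E → ℝ} (h : IsTestFunction Ω φ) {x : E}
    (hx : x ∉ Ω) : φ x = 0 :=
  image_eq_zero_of_notMem_tsupport fun h' => hx (h.2.2 h')

variable [FiniteDimensional ℝ E]

lemma norm_gradient_eq (φ : E → ℝ) (x : E) : ‖gradient φ x‖ = ‖fderiv ℝ φ x‖ := by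
  rw [gradient, LinearIsometryEquiv.norm_map]

lemma ContDiff.continuous_gradient {φ : E → ℝ} {n : WithTop ℕ∞} (h : ContDiff ℝ n φ)
    (hn : n ≠ 0) : Continuous (gradient φ) :=
  (InnerProductSpace.toDual ℝ E).symm.continuous.comp (h.continuous_fderiv hn)

lemma gradient_of_notMem_tsupport {φ : E → ℝ} {x : E} (hx : x ∉ tsupport φ) :
    gradient φ x = 0 := by
  rw [gradient, fderiv_of_notMem_tsupport ℝ hx, _root_.map_zero]

lemma HasCompactSupport.gradient {φ : E → ℝ} (h : HasCompactSupport φ) :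
    HasCompactSupport (gradient φ) :=
  HasCompactSupport.intro h fun _ hx => gradient_of_notMem_tsupport hx

lemma gradient_mul {φ ψ : E → ℝ} {x : E} (hφ : DifferentiableAt ℝ φ x)
    (hψ : DifferentiableAt ℝ ψ x) :
    gradient (fun y => φ y * ψ y) x = φ x • gradient ψ x + ψ x • gradient φ x := by
  rw [gradient, fderiv_fun_mul hφ hψ]
  simp [gradient]

lemma gradient_sub {φ ψ : E → ℝ} {x : E} (hφ : DifferentiableAt ℝ φ x)
    (hψ : DifferentiableAt ℝ ψ x) :
    gradient (fun y => φ y - ψ y) x = gradient φ x - gradient ψ x := by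
  rw [gradient, fderiv_fun_sub hφ hψ]
  simp [gradient]

lemma IsTestFunction.gradient_eq_zero {Ω : Set E} {φ : E → ℝ} (h : IsTestFunction Ω φ) {x : E}
    (hx : x ∉ Ω) : gradient φ x = 0 :=
  gradient_of_notMem_tsupport fun h' => hx (h.2.2 h')

lemma IsTestFunction.continuous_gradient {Ω : Set E} {φ : E → ℝ} (h : IsTestFunction Ω φ) :
    Continuous (gradient φ) := h.1.continuous_gradient (by simp)

variable [MeasurableSpace E] [BorelSpace E]

lemma integral_gradient_eq_zero {φ : E → ℝ} (h : ContDiff ℝ 1 φ) (hc : HasCompactSupport φ) :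
    ∫ x, gradient φ x = 0 := by
  refine ext_inner_right ℝ fun v => ?_
  have hi : Integrable (gradient φ) :=
    (h.continuous_gradient one_ne_zero).integrable_of_hasCompactSupport hc.gradient
  rw [inner_zero_left, real_inner_comm, ← integral_inner hi]
  have h1 : Integrable fun x => fderiv ℝ φ x v := by
    refine ((h.continuous_fderiv one_ne_zero).clm_apply continuous_const
      ).integrable_of_hasCompactSupport (hc.fderiv_apply ℝ v)
  have h2 := integral_mul_fderiv_eq_neg_fderiv_mul_of_integrable (μ := (volume : Measure E))
    (f := fun _ => (1 : ℝ)) (g := φ) (v := v) (by simp) (by simpa using h1)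
    (by simpa using h.continuous.integrable_of_hasCompactSupport hc) (by fun_prop)
    (fun x _ => (h.differentiable one_ne_zero) x)
  simp only [one_mul, fderiv_fun_const, Pi.zero_apply, zero_apply, zero_mul,
    integral_zero, neg_zero] at h2
  rw [← h2]
  exact integral_congr_ae (.of_forall fun x => by
    simp only
    rw [real_inner_comm, inner_gradient_left])

lemma IsTestFunction.memLp {Ω : Set E} {φ : E → ℝ} (h : IsTestFunction Ω φ) (P : ℝ≥0∞)
    (s : Set E) : MemLp φ P (volume.restrict s) :=
  (h.1.continuous.memLp_of_hasCompactSupport h.2.1).restrict s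

lemma IsTestFunction.memLp_gradient {Ω : Set E} {φ : E → ℝ} (h : IsTestFunction Ω φ) (P : ℝ≥0∞)
    (s : Set E) : MemLp (gradient φ) P (volume.restrict s) :=
  (h.continuous_gradient.memLp_of_hasCompactSupport h.2.1.gradient).restrict s

/-- The smooth functions `φ j` and their gradients converge in `L^p(Ω)` to `u` and `g`. The
`φ j` are smooth on the whole space, but no boundary condition is imposed on them. -/
structure SmoothApprox (p : ℝ) (Ω : Set E) (u : E → ℝ) (g : E → E) (φ : ℕ → E → ℝ) : Prop where
  contDiff : ∀ j, ContDiff ℝ ∞ (φ j)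
  memLp : MemLp u (ENNReal.ofReal p) (volume.restrict Ω)
  memLp_grad : MemLp g (ENNReal.ofReal p) (volume.restrict Ω)
  tendsto : Tendsto (fun j => eLpNorm (fun x => φ j x - u x) (ENNReal.ofReal p)
    (volume.restrict Ω)) atTop (𝓝 0)
  tendsto_grad : Tendsto (fun j => eLpNorm (fun x => gradient (φ j) x - g x) (ENNReal.ofReal p)
    (volume.restrict Ω)) atTop (𝓝 0)

lemma MemW01p.exists_approx {p : ℝ} {Ω : Set E} {u : E → ℝ} {g : E → E} (h : MemW01p p Ω u g) :
    ∃ φ : ℕ → E → ℝ, (∀ j, IsTestFunction Ω (φ j)) ∧ SmoothApprox p Ω u g φ := by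
  obtain ⟨⟨_, h1, h2⟩, φ, hφ, h3, h4⟩ := h
  exact ⟨φ, hφ, fun j => (hφ j).1, h1, h2, h3, h4⟩

lemma SmoothApprox.aesm {p : ℝ} {Ω : Set E} {u : E → ℝ} {g : E → E} {φ : ℕ → E → ℝ}
    (h : SmoothApprox p Ω u g φ) (j : ℕ) : AEStronglyMeasurable (φ j) (volume.restrict Ω) :=
  (h.contDiff j).continuous.aestronglyMeasurable

lemma SmoothApprox.aesm_grad {p : ℝ} {Ω : Set E} {u : E → ℝ} {g : E → E} {φ : ℕ → E → ℝ}
    (h : SmoothApprox p Ω u g φ) (j : ℕ) :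
    AEStronglyMeasurable (gradient (φ j)) (volume.restrict Ω) :=
  ((h.contDiff j).continuous_gradient (by simp)).aestronglyMeasurable

/-- Integration by parts against a test function is inherited by strong limits. -/
lemma SmoothApprox.hasWeakGradient {p : ℝ} (hp : 1 < p) {Ω : Set E} {u : E → ℝ}
    {g : E → E} {φ : ℕ → E → ℝ} (h : SmoothApprox p Ω u g φ) : HasWeakGradient Ω u g := by
  have hp1 : (1 : ℝ≥0∞) ≤ ENNReal.ofReal p := by
    rw [← ENNReal.ofReal_one]; exact ENNReal.ofReal_le_ofReal hp.le
  refine ⟨locallyIntegrableOn_of_locallyIntegrable_restrict (h.memLp.locallyIntegrable hp1),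
    locallyIntegrableOn_of_locallyIntegrable_restrict (h.memLp_grad.locallyIntegrable hp1),
    fun χ hχ => ?_⟩
  have := (Real.HolderConjugate.conjExponent hp).ennrealOfReal
  have h1 := tendsto_integral_bilin (P := ENNReal.ofReal p)
    (Q := ENNReal.ofReal p.conjExponent) (ContinuousLinearMap.lsmul ℝ ℝ (E := E)) h.memLp
    (hχ.memLp_gradient _ Ω) h.aesm h.tendsto
  have h2 := tendsto_integral_bilin (P := ENNReal.ofReal p)
    (Q := ENNReal.ofReal p.conjExponent) (ContinuousLinearMap.lsmul ℝ ℝ (E := E)).flip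
    h.memLp_grad (hχ.memLp _ Ω) h.aesm_grad h.tendsto_grad
  simp only [ContinuousLinearMap.lsmul_apply, ContinuousLinearMap.flip_apply] at h1 h2
  refine tendsto_nhds_unique h1 (h2.neg.congr fun j => ?_)
  have hd : ContDiff ℝ ∞ (fun x => φ j x * χ x) := (h.contDiff j).mul hχ.1
  have e1 : ∫ x in Ω, φ j x • gradient χ x = ∫ x, φ j x • gradient χ x :=
    setIntegral_eq_integral_of_forall_compl_eq_zero fun x hx => by
      rw [hχ.gradient_eq_zero hx, smul_zero]
  have e2 : ∫ x in Ω, χ x • gradient (φ j) x = ∫ x, χ x • gradient (φ j) x :=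
    setIntegral_eq_integral_of_forall_compl_eq_zero fun x hx => by
      rw [hχ.eq_zero hx, zero_smul]
  have i1 : Integrable fun x => φ j x • gradient χ x :=
    ((h.contDiff j).continuous.smul hχ.continuous_gradient).integrable_of_hasCompactSupport
      (hχ.2.1.gradient.smul_left)
  have i2 : Integrable fun x => χ x • gradient (φ j) x :=
    (hχ.1.continuous.smul ((h.contDiff j).continuous_gradient (by simp))
      ).integrable_of_hasCompactSupport hχ.2.1.smul_right
  have h3 := integral_gradient_eq_zero (hd.of_le (by simp)) (hχ.2.1.mul_left (f := φ j))
  have h4 : ∀ x, gradient (fun x => φ j x * χ x) x =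
      φ j x • gradient χ x + χ x • gradient (φ j) x := fun x =>
    gradient_mul ((h.contDiff j).differentiable (by simp) x) (hχ.1.differentiable (by simp) x)
  simp only [h4] at h3
  rw [integral_add i1 i2] at h3
  rw [e1, e2]
  exact (eq_neg_of_add_eq_zero_left h3).symm

lemma SmoothApprox.memW01p {p : ℝ} (hp : 1 < p) {Ω : Set E} {u : E → ℝ}
    {g : E → E} {φ : ℕ → E → ℝ} (h : SmoothApprox p Ω u g φ) (hφ : ∀ j, IsTestFunction Ω (φ j)) :
    MemW01p p Ω u g :=
  ⟨⟨h.hasWeakGradient hp, h.memLp, h.memLp_grad⟩, φ, hφ, h.tendsto, h.tendsto_grad⟩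

lemma IsTestFunction.memW01p {p : ℝ} (hp : 1 < p) {Ω : Set E} {φ : E → ℝ}
    (h : IsTestFunction Ω φ) : MemW01p p Ω φ (gradient φ) :=
  SmoothApprox.memW01p hp (φ := fun _ => φ)
    ⟨fun _ => h.1, h.memLp _ _, h.memLp_gradient _ _, by simp, by simp⟩ fun _ => h

lemma SmoothApprox.sub {p : ℝ} (hp : 1 < p) {Ω : Set E} {u v : E → ℝ} {g k : E → E}
    {φ ψ : ℕ → E → ℝ} (h : SmoothApprox p Ω u g φ) (h' : SmoothApprox p Ω v k ψ) :
    SmoothApprox p Ω (fun x => u x - v x) (fun x => g x - k x) (fun j x => φ j x - ψ j x) := by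
  have hp1 : (1 : ℝ≥0∞) ≤ ENNReal.ofReal p := by
    rw [← ENNReal.ofReal_one]; exact ENNReal.ofReal_le_ofReal hp.le
  refine ⟨fun j => (h.contDiff j).sub (h'.contDiff j), h.memLp.sub h'.memLp,
    h.memLp_grad.sub h'.memLp_grad, ?_, ?_⟩
  · refine tendsto_of_tendsto_of_tendsto_of_le_of_le tendsto_const_nhds
      (by simpa using h.tendsto.add h'.tendsto) (fun _ => zero_le) fun j => ?_
    refine le_trans (le_of_eq ?_) (eLpNorm_sub_le ((h.aesm j).sub h.memLp.1)
      ((h'.aesm j).sub h'.memLp.1) hp1)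
    congr 1
    ext x
    simp only [Pi.sub_apply]
    abel
  · refine tendsto_of_tendsto_of_tendsto_of_le_of_le tendsto_const_nhds
      (by simpa using h.tendsto_grad.add h'.tendsto_grad) (fun _ => zero_le) fun j => ?_
    refine le_trans (le_of_eq ?_) (eLpNorm_sub_le ((h.aesm_grad j).sub h.memLp_grad.1)
      ((h'.aesm_grad j).sub h'.memLp_grad.1) hp1)
    congr 1
    ext x
    simp only [Pi.sub_apply]
    rw [gradient_sub ((h.contDiff j).differentiable (by simp) x)
      ((h'.contDiff j).differentiable (by simp) x)]
    abel

lemma SmoothApprox.mul {p : ℝ} (hp : 1 < p) {Ω : Set E} {u : E → ℝ} {g : E → E}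
    {φ : ℕ → E → ℝ} (h : SmoothApprox p Ω u g φ) {η : E → ℝ} (hη : ContDiff ℝ ∞ η) {K L : ℝ}
    (hK : ∀ x, ‖η x‖ ≤ K) (hL : ∀ x, ‖gradient η x‖ ≤ L) :
    SmoothApprox p Ω (fun x => η x * u x) (fun x => η x • g x + u x • gradient η x)
      (fun j x => η x * φ j x) := by
  have hp1 : (1 : ℝ≥0∞) ≤ ENNReal.ofReal p := by
    rw [← ENNReal.ofReal_one]; exact ENNReal.ofReal_le_ofReal hp.le
  have mη : AEStronglyMeasurable η (volume.restrict Ω) := hη.continuous.aestronglyMeasurable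
  have mg : AEStronglyMeasurable (gradient η) (volume.restrict Ω) :=
    (hη.continuous_gradient (by simp)).aestronglyMeasurable
  have b1 : ∀ {f : E → ℝ} x, ‖η x * f x‖ ≤ K * ‖f x‖ := fun x => by
    rw [norm_mul]; exact mul_le_mul_of_nonneg_right (hK x) (norm_nonneg _)
  have b2 : ∀ {f : E → E} x, ‖η x • f x‖ ≤ K * ‖f x‖ := fun x => by
    rw [norm_smul]; exact mul_le_mul_of_nonneg_right (hK x) (norm_nonneg _)
  have b3 : ∀ {f : E → ℝ} x, ‖f x • gradient η x‖ ≤ L * ‖f x‖ := fun x => by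
    rw [norm_smul, mul_comm]; exact mul_le_mul_of_nonneg_right (hL x) (norm_nonneg _)
  refine ⟨fun j => hη.mul (h.contDiff j), h.memLp.of_le_mul (mη.mul h.memLp.1) (.of_forall b1),
    (h.memLp_grad.of_le_mul (mη.smul h.memLp_grad.1) (.of_forall b2)).add
      (h.memLp.of_le_mul (h.memLp.1.smul mg) (.of_forall b3)), ?_, ?_⟩
  · have lim := ENNReal.Tendsto.const_mul (a := ENNReal.ofReal K) h.tendsto
      (.inr ENNReal.ofReal_ne_top)
    rw [mul_zero] at lim
    refine tendsto_of_tendsto_of_tendsto_of_le_of_le tendsto_const_nhds lim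
      (fun _ => zero_le) fun j => ?_
    refine eLpNorm_le_mul_eLpNorm_of_ae_le_mul (.of_forall fun x => ?_) _
    rw [← mul_sub]
    exact b1 (f := fun x => φ j x - u x) x
  · have lim := (ENNReal.Tendsto.const_mul (a := ENNReal.ofReal K) h.tendsto_grad
      (.inr ENNReal.ofReal_ne_top)).add (ENNReal.Tendsto.const_mul (a := ENNReal.ofReal L)
        h.tendsto (.inr ENNReal.ofReal_ne_top))
    rw [mul_zero, mul_zero, add_zero] at lim
    refine tendsto_of_tendsto_of_tendsto_of_le_of_le tendsto_const_nhds lim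
      (fun _ => zero_le) fun j => ?_
    have e : (fun x => gradient (fun x => η x * φ j x) x - (η x • g x + u x • gradient η x)) =
        (fun x => η x • (gradient (φ j) x - g x)) + fun x => (φ j x - u x) • gradient η x := by
      ext x
      rw [gradient_mul (hη.differentiable (by simp) x) ((h.contDiff j).differentiable (by simp) x)]
      simp only [Pi.add_apply, smul_sub, sub_smul]
      abel
    rw [e]
    refine (eLpNorm_add_le (mη.smul ((h.aesm_grad j).sub h.memLp_grad.1))
      (((h.aesm j).sub h.memLp.1).smul mg) hp1).trans (add_le_add ?_ ?_)
    · exact eLpNorm_le_mul_eLpNorm_of_ae_le_mul (.of_forall fun x =>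
        b2 (f := fun x => gradient (φ j) x - g x) x) _
    · exact eLpNorm_le_mul_eLpNorm_of_ae_le_mul (.of_forall fun x =>
        b3 (f := fun x => φ j x - u x) x) _

/-- A weak equation with data in the dual exponent need only be tested with test functions. -/
lemma MemW01p.integral_eq_of_isTestFunction {p : ℝ} (hp : 1 < p) {Ω : Set E} {V : E → E}
    {f : E → ℝ} (hV : MemLp V (ENNReal.ofReal (p / (p - 1))) (volume.restrict Ω))
    (hf : MemLp f (ENNReal.ofReal (p / (p - 1))) (volume.restrict Ω))
    (h : ∀ φ, IsTestFunction Ω φ → ∫ x in Ω, ⟪V x, gradient φ x⟫ = ∫ x in Ω, f x * φ x)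
    {u : E → ℝ} {g : E → E} (hu : MemW01p p Ω u g) :
    ∫ x in Ω, ⟪V x, g x⟫ = ∫ x in Ω, f x * u x := by
  obtain ⟨φ, hφ, ha⟩ := hu.exists_approx
  have := (Real.HolderConjugate.conjExponent hp).ennrealOfReal
  have h1 := tendsto_integral_bilin (P := ENNReal.ofReal p)
    (Q := ENNReal.ofReal p.conjExponent) (innerSL ℝ (E := E)).flip ha.memLp_grad hV
    ha.aesm_grad
    ha.tendsto_grad
  have h2 := tendsto_integral_bilin (P := ENNReal.ofReal p)
    (Q := ENNReal.ofReal p.conjExponent) (ContinuousLinearMap.mul ℝ ℝ).flip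
    ha.memLp hf ha.aesm ha.tendsto
  simp only [ContinuousLinearMap.flip_apply, innerSL_apply_apply,
    ContinuousLinearMap.mul_apply'] at h1 h2
  refine (tendsto_nhds_unique h1 (h2.congr fun j => ?_))
  rw [← h _ (hφ j)]

/-! ### The Poincaré inequality in one direction -/

/-- Integrate `|φ|^p = |φ|^p ∂ₑ⟪x, e⟫` by parts. -/
lemma integral_rpow_le_of_hasCompactSupport {p : ℝ} (hp : 1 < p) {φ : E → ℝ}
    (hφ : ContDiff ℝ 1 φ) (hc : HasCompactSupport φ) {e : E} (he : ‖e‖ = 1) {R : ℝ} (hR : 0 ≤ R)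
    (hs : ∀ x, φ x ≠ 0 → |⟪x, e⟫| ≤ R) :
    ∫ x, ‖φ x‖ ^ p ≤ (p * R) ^ p * ∫ x, ‖⟪gradient φ x, e⟫‖ ^ p := by
  have hp0 : 0 < p := by linarith
  have hg1 : Continuous fun x => ⟪gradient φ x, e⟫ :=
    (hφ.continuous_gradient one_ne_zero).inner continuous_const
  have hgc : HasCompactSupport fun x => ⟪gradient φ x, e⟫ :=
    HasCompactSupport.intro hc fun x hx => by rw [gradient_of_notMem_tsupport hx, inner_zero_left]
  have hN : ContDiff ℝ 1 fun x => ‖φ x‖ ^ p := hφ.norm_rpow hp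
  have hNc : HasCompactSupport fun x => ‖φ x‖ ^ p :=
    HasCompactSupport.intro hc fun x hx => by
      rw [image_eq_zero_of_notMem_tsupport hx, norm_zero, Real.zero_rpow hp0.ne']
  have hl : ∀ x, HasFDerivAt (fun y : E => ⟪y, e⟫) (innerSL ℝ e) x := fun x => by
    have := (innerSL ℝ e).hasFDerivAt (x := x)
    refine this.congr_of_eventuallyEq (.of_forall fun y => ?_)
    simp [real_inner_comm]
  have hd : ∀ x, |fderiv ℝ (fun x => ‖φ x‖ ^ p) x e| ≤
      p * (‖φ x‖ ^ (p - 1) * ‖⟪gradient φ x, e⟫‖) :=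
    fun x => by
      rw [(hφ.differentiable one_ne_zero).fderiv_norm_rpow hp, inner_gradient_left]
      simp only [smul_apply, ContinuousLinearMap.comp_apply,
        innerSL_apply_apply, smul_eq_mul, abs_mul, abs_of_pos hp0, Real.norm_eq_abs]
      have : ⟪φ x, fderiv ℝ φ x e⟫ = φ x * fderiv ℝ φ x e := by simp [mul_comm]
      rw [this, abs_mul, mul_assoc, ← mul_assoc (|_ ^ _|), abs_of_nonneg (by positivity)]
      rcases eq_or_ne (φ x) 0 with h0 | h0
      · rw [h0]; simp [Real.zero_rpow (by linarith : p - 1 ≠ 0)]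
      · rw [← Real.rpow_add_one (abs_ne_zero.2 h0)]
        ring_nf
        rfl
  have hci : Continuous fun x : E => ⟪x, e⟫ := by fun_prop
  have hfd : Continuous fun x => fderiv ℝ (fun x => ‖φ x‖ ^ p) x e :=
    (hN.continuous_fderiv one_ne_zero).clm_apply continuous_const
  have i1 : Integrable fun x => fderiv ℝ (fun x => ‖φ x‖ ^ p) x e * ⟪x, e⟫ :=
    (hfd.mul hci).integrable_of_hasCompactSupport (hNc.fderiv_apply ℝ e).mul_right
  have i2 : Integrable fun x => ‖φ x‖ ^ p :=
    hN.continuous.integrable_of_hasCompactSupport hNc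
  have hprod : Continuous fun x => ‖φ x‖ ^ (p - 1) * ‖⟪gradient φ x, e⟫‖ :=
    (hφ.continuous.norm.rpow_const fun _ => .inr (by linarith)).mul hg1.norm
  have i3 : Integrable fun x => ‖φ x‖ ^ (p - 1) * ‖⟪gradient φ x, e⟫‖ :=
    hprod.integrable_of_hasCompactSupport hgc.norm.mul_left
  have key := integral_mul_fderiv_eq_neg_fderiv_mul_of_integrable (μ := (volume : Measure E))
    (f := fun x => ‖φ x‖ ^ p) (g := fun x => ⟪x, e⟫) (v := e) i1
    (by simpa [(hl _).fderiv, he] using i2)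
    ((hN.continuous.mul hci).integrable_of_hasCompactSupport hNc.mul_right)
    (fun x _ => hN.differentiable one_ne_zero x) fun x _ => (hl x).differentiableAt
  simp only [(hl _).fderiv, innerSL_apply_apply, real_inner_self_eq_norm_sq, he, one_pow,
    mul_one] at key
  have h1 : ∫ x, ‖φ x‖ ^ p ≤ p * R * ∫ x, ‖φ x‖ ^ (p - 1) * ‖⟪gradient φ x, e⟫‖ := by
    rw [key, ← integral_neg, ← integral_const_mul]
    refine integral_mono i1.neg (i3.const_mul _) fun x => ?_
    simp only
    refine (neg_le_abs _).trans ?_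
    rw [abs_mul]
    rcases eq_or_ne (φ x) 0 with h0 | h0
    · have := hd x
      rw [h0, norm_zero, Real.zero_rpow (by linarith : p - 1 ≠ 0), zero_mul, mul_zero] at this
      rw [le_antisymm this (abs_nonneg _), h0, norm_zero,
        Real.zero_rpow (by linarith : p - 1 ≠ 0)]
      simp
    · calc _ ≤ p * (‖φ x‖ ^ (p - 1) * ‖⟪gradient φ x, e⟫‖) * R :=
          mul_le_mul (hd x) (hs x h0) (abs_nonneg _) (by positivity)
        _ = _ := by ring
  have hconj := Real.HolderConjugate.conjExponent hp
  have h2 := integral_mul_le_Lp_mul_Lq_of_nonneg (μ := (volume : Measure E)) hconj.symm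
    (f := fun x => ‖φ x‖ ^ (p - 1)) (g := fun x => ‖⟪gradient φ x, e⟫‖)
    (.of_forall fun x => by positivity) (.of_forall fun x => norm_nonneg _)
    ((hφ.continuous.norm.rpow_const fun _ => .inr (by linarith)).memLp_of_hasCompactSupport
      (HasCompactSupport.intro hc fun x hx => by
        rw [image_eq_zero_of_notMem_tsupport hx, norm_zero,
          Real.zero_rpow (by linarith : p - 1 ≠ 0)]))
    (hg1.norm.memLp_of_hasCompactSupport hgc.norm)
  have h3 : ∀ x, (‖φ x‖ ^ (p - 1)) ^ p.conjExponent = ‖φ x‖ ^ p := fun x => by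
    rw [← Real.rpow_mul (norm_nonneg _), Real.conjExponent,
      mul_div_cancel₀ _ (by linarith : p - 1 ≠ 0)]
  simp only [h3] at h2
  have h4 : 1 / p.conjExponent = 1 - 1 / p := by
    rw [Real.conjExponent]; field_simp
  rw [h4] at h2
  have h5 := le_rpow_mul_of_le_mul_rpow (X := ∫ x, ‖φ x‖ ^ p) (b := p * R)
    (M := ∫ x, ‖⟪gradient φ x, e⟫‖ ^ p) (s := 1 / p) (integral_nonneg fun x => by positivity)
    (by positivity) (integral_nonneg fun x => by positivity) (by positivity) (by
      refine h1.trans ?_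
      rw [mul_assoc (p * R)]
      refine mul_le_mul_of_nonneg_left (h2.trans_eq (mul_comm _ _)) (by positivity))
  simpa using h5

lemma MeasureTheory.MemLp.eLpNorm_ofReal_eq {α F : Type*} [MeasurableSpace α] {μ : Measure α}
    [NormedAddCommGroup F] {p : ℝ} (hp : 0 < p) {u : α → F} (hu : MemLp u (ENNReal.ofReal p) μ) :
    eLpNorm u (ENNReal.ofReal p) μ = ENNReal.ofReal ((∫ x, ‖u x‖ ^ p ∂μ) ^ (1 / p)) := by
  rw [hu.eLpNorm_eq_integral_rpow_norm (by simpa using hp) ENNReal.ofReal_ne_top,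
    ENNReal.toReal_ofReal hp.le, one_div]

lemma IsTestFunction.eLpNorm_le {p : ℝ} (hp : 1 < p) {Ω : Set E} {φ : E → ℝ}
    (hφ : IsTestFunction Ω φ) {e : E} (he : ‖e‖ = 1) {R : ℝ} (hR : 0 ≤ R)
    (hs : ∀ x ∈ Ω, |⟪x, e⟫| ≤ R) :
    eLpNorm φ (ENNReal.ofReal p) (volume.restrict Ω) ≤ ENNReal.ofReal (p * R) *
      eLpNorm (fun x => ⟪gradient φ x, e⟫) (ENNReal.ofReal p) (volume.restrict Ω) := by
  have hp0 : 0 < p := by linarith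
  have h1 := integral_rpow_le_of_hasCompactSupport hp (hφ.1.of_le (by simp)) hφ.2.1 he hR
    fun x hx => hs x (by_contra fun h => hx (hφ.eq_zero h))
  have m2 : MemLp (fun x => ⟪gradient φ x, e⟫) (ENNReal.ofReal p) (volume.restrict Ω) :=
    (hφ.memLp_gradient _ _).inner_const e
  rw [(hφ.memLp _ _).eLpNorm_ofReal_eq hp0, m2.eLpNorm_ofReal_eq hp0,
    setIntegral_eq_integral_of_forall_compl_eq_zero fun x hx => by
      rw [hφ.eq_zero hx, norm_zero, Real.zero_rpow hp0.ne'],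
    setIntegral_eq_integral_of_forall_compl_eq_zero fun x hx => by
      rw [hφ.gradient_eq_zero hx, inner_zero_left, norm_zero, Real.zero_rpow hp0.ne'],
    ← ENNReal.ofReal_mul (by positivity)]
  refine ENNReal.ofReal_le_ofReal ((Real.rpow_le_rpow (by positivity) h1 (by positivity)).trans_eq
    ?_)
  rw [Real.mul_rpow (by positivity) (by positivity), ← Real.rpow_mul (by positivity),
    mul_one_div_cancel hp0.ne', Real.rpow_one]

/-- Only the derivative in the direction `e` appears on the right: this is what allows weights that
are constant in this direction. -/
lemma MemW01p.eLpNorm_le {p : ℝ} (hp : 1 < p) {Ω : Set E} {u : E → ℝ} {g : E → E}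
    (hu : MemW01p p Ω u g) {e : E} (he : ‖e‖ = 1) {R : ℝ} (hR : 0 ≤ R)
    (hs : ∀ x ∈ Ω, |⟪x, e⟫| ≤ R) :
    eLpNorm u (ENNReal.ofReal p) (volume.restrict Ω) ≤ ENNReal.ofReal (p * R) *
      eLpNorm (fun x => ⟪g x, e⟫) (ENNReal.ofReal p) (volume.restrict Ω) := by
  have hp1 : (1 : ℝ≥0∞) ≤ ENNReal.ofReal p := by
    rw [← ENNReal.ofReal_one]; exact ENNReal.ofReal_le_ofReal hp.le
  obtain ⟨φ, hφ, ha⟩ := hu.exists_approx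
  set C := ENNReal.ofReal (p * R)
  set N := eLpNorm (fun x => ⟪g x, e⟫) (ENNReal.ofReal p) (volume.restrict Ω)
  have hlim : Tendsto (fun j => eLpNorm (fun x => φ j x - u x) (ENNReal.ofReal p)
      (volume.restrict Ω) + C * (eLpNorm (fun x => gradient (φ j) x - g x) (ENNReal.ofReal p)
      (volume.restrict Ω) + N)) atTop (𝓝 (0 + C * (0 + N))) :=
    ha.tendsto.add (ENNReal.Tendsto.const_mul (ha.tendsto_grad.add tendsto_const_nhds)
      (.inr ENNReal.ofReal_ne_top))
  rw [zero_add, zero_add] at hlim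
  refine ge_of_tendsto' hlim fun j => ?_
  have h1 : eLpNorm u (ENNReal.ofReal p) (volume.restrict Ω) ≤
      eLpNorm (fun x => φ j x - u x) (ENNReal.ofReal p) (volume.restrict Ω) +
      eLpNorm (φ j) (ENNReal.ofReal p) (volume.restrict Ω) := by
    have e1 : u = φ j - fun x => φ j x - u x := by ext x; simp
    nth_rewrite 1 [e1]
    rw [add_comm]
    exact eLpNorm_sub_le (ha.aesm j) ((ha.aesm j).sub ha.memLp.1) hp1
  refine h1.trans (add_le_add_right (((hφ j).eLpNorm_le hp he hR hs).trans ?_) _)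
  gcongr
  have m1 : AEStronglyMeasurable (fun x => gradient (φ j) x - g x) (volume.restrict Ω) :=
    (ha.aesm_grad j).sub ha.memLp_grad.1
  have e1 : (fun x => ⟪gradient (φ j) x, e⟫) =
      (fun x => ⟪gradient (φ j) x - g x, e⟫) + fun x => ⟪g x, e⟫ := by
    ext x; simp [inner_sub_left]
  rw [e1]
  refine (eLpNorm_add_le (m1.inner_const (c := e))
    (ha.memLp_grad.1.inner_const (c := e)) hp1).trans (add_le_add_left ?_ _)
  refine eLpNorm_mono fun x => ?_
  simpa [he] using norm_inner_le_norm (𝕜 := ℝ) (gradient (φ j) x - g x) e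

end Sobolev

/-! ### Cut-off functions of the longitudinal variable -/

lemma exists_scaled_cutoff {F : Type*} [NormedAddCommGroup F] [InnerProductSpace ℝ F]
    [FiniteDimensional ℝ F] {U : Set F} (ho : IsOpen U) (hb : Bornology.IsBounded U)
    (hc : Convex ℝ U) (h0 : (0 : F) ∈ U) :
    ∃ K : ℝ, 0 ≤ K ∧ ∀ ℓ : ℝ, 0 < ℓ → ∃ η : F → ℝ, IsTestFunction (ℓ • U) η ∧
      (∀ x, η x ∈ Icc (0 : ℝ) 1) ∧ (∀ x ∈ (ℓ / 2) • U, η x = 1) ∧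
      ∀ x, ‖gradient η x‖ ≤ K / ℓ := by
  obtain ⟨χ, h1, h2, h3, h4, h5⟩ := Convex.exists_cutoff ho hb hc h0
  obtain ⟨K, hK⟩ := (h1.continuous_fderiv (by simp)).bounded_above_of_compact_support (h2.fderiv ℝ)
  refine ⟨K, (norm_nonneg _).trans (hK 0), fun ℓ hℓ => ⟨fun x => χ (ℓ⁻¹ • x), ⟨?_, ?_, ?_⟩,
    fun x => h4 _, ?_, ?_⟩⟩
  · exact h1.comp (contDiff_const_smul _)
  · exact h2.comp_smul (inv_ne_zero hℓ.ne')
  · refine (tsupport_comp_subset_preimage χ (continuous_const_smul ℓ⁻¹)).trans fun x hx => ?_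
    exact (mem_smul_set_iff_inv_smul_mem₀ hℓ.ne' _ _).2 (h3 hx)
  · intro x hx
    refine h5 _ ?_
    rw [mem_smul_set_iff_inv_smul_mem₀ (by positivity)] at hx ⊢
    rw [smul_smul]
    convert hx using 2
    field_simp
  · intro x
    have hd : HasFDerivAt (fun x => χ (ℓ⁻¹ • x))
        ((fderiv ℝ χ (ℓ⁻¹ • x)).comp (ℓ⁻¹ • ContinuousLinearMap.id ℝ F)) x :=
      ((h1.differentiable (by simp)) _).hasFDerivAt.comp x ((hasFDerivAt_id x).const_smul ℓ⁻¹)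
    rw [norm_gradient_eq, hd.fderiv]
    simp only [ContinuousLinearMap.comp_smul, ContinuousLinearMap.comp_id, norm_smul, norm_inv,
      Real.norm_of_nonneg hℓ.le]
    rw [div_eq_inv_mul]
    exact mul_le_mul_of_nonneg_left (hK _) (by positivity)

lemma gradient_pow {E : Type*} [NormedAddCommGroup E] [InnerProductSpace ℝ E]
    [FiniteDimensional ℝ E] {η : E → ℝ} {x : E} (h : DifferentiableAt ℝ η x) (n : ℕ) :
    gradient (fun y => η y ^ n) x = (n * η x ^ (n - 1)) • gradient η x := by
  rw [gradient, fderiv_fun_pow _ h]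
  simp [gradient]

/-! ### Cylinders -/

section Cylinder

variable {m k : ℕ}

-- A shortcut: the general search for this instance through `WithLp` exceeds the default limits.
instance ProdSpace.continuousSMul : ContinuousSMul ℝ (ProdSpace m k) :=
  IsBoundedSMul.continuousSMul

/-- The projection of the cylinder space onto the longitudinal variables. -/
def fstCLM (m k : ℕ) : ProdSpace m k →L[ℝ] EuclideanSpace ℝ (Fin m) :=
  (ContinuousLinearMap.fst ℝ _ _).comp
    (WithLp.prodContinuousLinearEquiv 2 ℝ (EuclideanSpace ℝ (Fin m))
      (EuclideanSpace ℝ (Fin k))).toContinuousLinearMap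

/-- The projection of the cylinder space onto the variables of the cross-section. -/
def sndCLM (m k : ℕ) : ProdSpace m k →L[ℝ] EuclideanSpace ℝ (Fin k) :=
  (ContinuousLinearMap.snd ℝ _ _).comp
    (WithLp.prodContinuousLinearEquiv 2 ℝ (EuclideanSpace ℝ (Fin m))
      (EuclideanSpace ℝ (Fin k))).toContinuousLinearMap

@[simp] lemma fstCLM_apply (x : ProdSpace m k) : fstCLM m k x = x.fst := rfl

@[simp] lemma sndCLM_apply (x : ProdSpace m k) : sndCLM m k x = x.snd := rfl

lemma continuous_prodSpace_fst : Continuous fun x : ProdSpace m k => x.fst :=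
  (fstCLM m k).continuous

lemma continuous_prodSpace_snd : Continuous fun x : ProdSpace m k => x.snd :=
  (sndCLM m k).continuous

lemma inner_prodSpace (x y : ProdSpace m k) : ⟪x, y⟫ = ⟪x.fst, y.fst⟫ + ⟪x.snd, y.snd⟫ := rfl

lemma gradient_comp_fst {η : EuclideanSpace ℝ (Fin m) → ℝ} (h : Differentiable ℝ η)
    (x : ProdSpace m k) :
    gradient (fun y : ProdSpace m k => η y.fst) x = WithLp.toLp 2 (gradient η x.fst, 0) := by
  have hd : HasFDerivAt (fun y : ProdSpace m k => η y.fst)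
      ((fderiv ℝ η x.fst).comp (fstCLM m k)) x :=
    (h x.fst).hasFDerivAt.comp x (fstCLM m k).hasFDerivAt
  refine ext_inner_right ℝ fun v => ?_
  rw [inner_gradient_left, hd.fderiv, inner_prodSpace]
  simp [inner_gradient_left]

lemma gradient_comp_snd {ψ : EuclideanSpace ℝ (Fin k) → ℝ} (h : Differentiable ℝ ψ)
    (x : ProdSpace m k) :
    gradient (fun y : ProdSpace m k => ψ y.snd) x = WithLp.toLp 2 (0, gradient ψ x.snd) := by
  have hd : HasFDerivAt (fun y : ProdSpace m k => ψ y.snd)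
      ((fderiv ℝ ψ x.snd).comp (sndCLM m k)) x :=
    (h x.snd).hasFDerivAt.comp x (sndCLM m k).hasFDerivAt
  refine ext_inner_right ℝ fun v => ?_
  rw [inner_gradient_left, hd.fderiv, inner_prodSpace]
  simp [inner_gradient_left]

/-- The inclusion `X₁ ↦ (X₁, 0)`. -/
def inlCLM (m k : ℕ) : EuclideanSpace ℝ (Fin m) →L[ℝ] ProdSpace m k :=
  (WithLp.prodContinuousLinearEquiv 2 ℝ (EuclideanSpace ℝ (Fin m))
      (EuclideanSpace ℝ (Fin k))).symm.toContinuousLinearMap.comp (ContinuousLinearMap.inl ℝ _ _)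

/-- The inclusion `X₂ ↦ (0, X₂)`. -/
def inrCLM (m k : ℕ) : EuclideanSpace ℝ (Fin k) →L[ℝ] ProdSpace m k :=
  (WithLp.prodContinuousLinearEquiv 2 ℝ (EuclideanSpace ℝ (Fin m))
      (EuclideanSpace ℝ (Fin k))).symm.toContinuousLinearMap.comp (ContinuousLinearMap.inr ℝ _ _)

lemma inlCLM_apply (a : EuclideanSpace ℝ (Fin m)) : inlCLM m k a = WithLp.toLp 2 (a, 0) := rfl

lemma inrCLM_apply (b : EuclideanSpace ℝ (Fin k)) : inrCLM m k b = WithLp.toLp 2 (0, b) := rfl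

lemma toLp_eq_inl_add_inr (a : EuclideanSpace ℝ (Fin m)) (b : EuclideanSpace ℝ (Fin k)) :
    WithLp.toLp 2 (a, b) = inlCLM m k a + inrCLM m k b := by
  rw [inlCLM_apply, inrCLM_apply, ← WithLp.toLp_add]
  simp

lemma contDiff_toLp_left (b : EuclideanSpace ℝ (Fin k)) :
    ContDiff ℝ ∞ fun a : EuclideanSpace ℝ (Fin m) => (WithLp.toLp 2 (a, b) : ProdSpace m k) := by
  simp only [toLp_eq_inl_add_inr]
  exact (inlCLM m k).contDiff.add contDiff_const

lemma contDiff_toLp_right (a : EuclideanSpace ℝ (Fin m)) :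
    ContDiff ℝ ∞ fun b : EuclideanSpace ℝ (Fin k) => (WithLp.toLp 2 (a, b) : ProdSpace m k) := by
  simp only [toLp_eq_inl_add_inr]
  exact contDiff_const.add (inrCLM m k).contDiff

lemma gradient_slice_left {φ : ProdSpace m k → ℝ} (h : Differentiable ℝ φ)
    (a : EuclideanSpace ℝ (Fin m)) (b : EuclideanSpace ℝ (Fin k)) :
    gradient (fun a' => φ (WithLp.toLp 2 (a', b))) a =
      (gradient φ (WithLp.toLp 2 (a, b))).fst := by
  have hd : HasFDerivAt (fun a' => φ (WithLp.toLp 2 (a', b)))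
      ((fderiv ℝ φ (WithLp.toLp 2 (a, b))).comp (inlCLM m k)) a := by
    refine (h _).hasFDerivAt.comp a ?_
    simp only [toLp_eq_inl_add_inr]
    exact (inlCLM m k).hasFDerivAt.add_const _
  refine ext_inner_right ℝ fun v => ?_
  rw [inner_gradient_left, hd.fderiv, ContinuousLinearMap.comp_apply, ← inner_gradient_left,
    inner_prodSpace, inlCLM_apply]
  simp

lemma gradient_slice_right {φ : ProdSpace m k → ℝ} (h : Differentiable ℝ φ)
    (a : EuclideanSpace ℝ (Fin m)) (b : EuclideanSpace ℝ (Fin k)) :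
    gradient (fun b' => φ (WithLp.toLp 2 (a, b'))) b =
      (gradient φ (WithLp.toLp 2 (a, b))).snd := by
  have hd : HasFDerivAt (fun b' => φ (WithLp.toLp 2 (a, b')))
      ((fderiv ℝ φ (WithLp.toLp 2 (a, b))).comp (inrCLM m k)) b := by
    refine (h _).hasFDerivAt.comp b ?_
    simp only [toLp_eq_inl_add_inr]
    exact (inrCLM m k).hasFDerivAt.const_add _
  refine ext_inner_right ℝ fun v => ?_
  rw [inner_gradient_left, hd.fderiv, ContinuousLinearMap.comp_apply, ← inner_gradient_left,
    inner_prodSpace, inrCLM_apply]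
  simp

variable {U : Set (EuclideanSpace ℝ (Fin m))} {ω₂ : Set (EuclideanSpace ℝ (Fin k))} {ℓ : ℝ}

lemma hasCompactSupport_slice_left {φ : ProdSpace m k → ℝ} (h : HasCompactSupport φ)
    (b : EuclideanSpace ℝ (Fin k)) : HasCompactSupport fun a => φ (WithLp.toLp 2 (a, b)) :=
  HasCompactSupport.intro (K := (fun x : ProdSpace m k => x.fst) '' tsupport φ)
    (h.isCompact.image continuous_prodSpace_fst) fun _ ha =>
      image_eq_zero_of_notMem_tsupport fun h' => ha ⟨_, h', rfl⟩

lemma IsTestFunction.slice_right {φ : ProdSpace m k → ℝ}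
    (h : IsTestFunction (finiteCylinder U ω₂ ℓ) φ) (a : EuclideanSpace ℝ (Fin m)) :
    IsTestFunction ω₂ fun b => φ (WithLp.toLp 2 (a, b)) := by
  refine ⟨h.1.comp (contDiff_toLp_right a), ?_, ?_⟩
  · exact HasCompactSupport.intro (K := (fun x : ProdSpace m k => x.snd) '' tsupport φ)
      (h.2.1.isCompact.image continuous_prodSpace_snd) fun b hb =>
        image_eq_zero_of_notMem_tsupport fun h' => hb ⟨_, h', rfl⟩
  · exact (tsupport_comp_subset_preimage φ (contDiff_toLp_right a).continuous).trans
      fun b hb => (h.2.2 hb).2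

lemma IsTestFunction.mul_snd {η : EuclideanSpace ℝ (Fin m) → ℝ}
    {ψ : EuclideanSpace ℝ (Fin k) → ℝ} (hη : IsTestFunction (ℓ • U) η)
    (hψ : IsTestFunction ω₂ ψ) :
    IsTestFunction (finiteCylinder U ω₂ ℓ) fun x => η x.fst * ψ x.snd := by
  have hK : IsCompact ((fun x : ProdSpace m k => (x.fst, x.snd)) ⁻¹'
      (tsupport η ×ˢ tsupport ψ)) :=
    (WithLp.prodContinuousLinearEquiv 2 ℝ (EuclideanSpace ℝ (Fin m))
      (EuclideanSpace ℝ (Fin k))).toHomeomorph.isCompact_preimage.2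
        (hη.2.1.isCompact.prod hψ.2.1.isCompact)
  have hs : tsupport (fun x : ProdSpace m k => η x.fst * ψ x.snd) ⊆
      (fun x : ProdSpace m k => (x.fst, x.snd)) ⁻¹' (tsupport η ×ˢ tsupport ψ) :=
    closure_minimal (fun x hx => ⟨subset_tsupport _ (left_ne_zero_of_mul hx),
      subset_tsupport _ (right_ne_zero_of_mul hx)⟩) hK.isClosed
  exact ⟨(hη.1.comp (fstCLM m k).contDiff).mul (hψ.1.comp (sndCLM m k).contDiff),
    hK.of_isClosed_subset (isClosed_tsupport _) hs,
    fun x hx => ⟨hη.2.2 (hs hx).1, hψ.2.2 (hs hx).2⟩⟩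

/-- A function of `X₁` cuts off the longitudinal boundary, so that the product with the difference
of a test function on the cylinder and one on the cross-section is again a test function. -/
lemma IsTestFunction.mul_sub_snd {η : EuclideanSpace ℝ (Fin m) → ℝ}
    {ψ : EuclideanSpace ℝ (Fin k) → ℝ} {φ : ProdSpace m k → ℝ} (hη : IsTestFunction (ℓ • U) η)
    (hφ : IsTestFunction (finiteCylinder U ω₂ ℓ) φ) (hψ : IsTestFunction ω₂ ψ) :
    IsTestFunction (finiteCylinder U ω₂ ℓ) fun x => η x.fst * (φ x - ψ x.snd) := by
  have h1 := hη.mul_snd (U := U) (ℓ := ℓ) hψ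
  have e : (fun x : ProdSpace m k => η x.fst * (φ x - ψ x.snd)) =
      (fun x => η x.fst * φ x) + fun x => -(η x.fst * ψ x.snd) := by
    ext x; simp only [Pi.add_apply]; ring
  have hs1 : tsupport (fun x : ProdSpace m k => η x.fst * φ x) ⊆ tsupport φ :=
    tsupport_mul_subset_right
  have hs2 : tsupport (fun x : ProdSpace m k => -(η x.fst * ψ x.snd)) ⊆
      tsupport fun x : ProdSpace m k => η x.fst * ψ x.snd :=
    closure_mono fun x hx => by simpa using hx
  rw [e]
  refine ⟨((hη.1.comp (fstCLM m k).contDiff).mul hφ.1).add h1.1.neg, ?_, ?_⟩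
  · exact (hφ.2.1.mul_left (f := fun x : ProdSpace m k => η x.fst)).add
      (h1.2.1.of_isClosed_subset (isClosed_tsupport _) hs2)
  · exact (tsupport_add _ _).trans (union_subset (hs1.trans hφ.2.2) (hs2.trans h1.2.2))

lemma IsTestFunction.pow {E : Type*} [NormedAddCommGroup E] [InnerProductSpace ℝ E] {Ω : Set E}
    {η : E → ℝ} (h : IsTestFunction Ω η) {n : ℕ} (hn : n ≠ 0) :
    IsTestFunction Ω fun x => η x ^ n := by
  have hs : tsupport (fun x => η x ^ n) ⊆ tsupport η :=
    closure_mono fun x hx => by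
      rw [Function.mem_support] at hx ⊢
      exact fun h0 => hx (by rw [h0, zero_pow hn])
  exact ⟨h.1.pow n, h.2.1.of_isClosed_subset (isClosed_tsupport _) hs, hs.trans h.2.2⟩

/-! ### Integration over cylinders -/

lemma isOpen_finiteCylinder (hU : IsOpen U) (h2 : IsOpen ω₂) (hℓ : ℓ ≠ 0) :
    IsOpen (finiteCylinder U ω₂ ℓ) :=
  ((hU.smul₀ hℓ).preimage continuous_prodSpace_fst).inter (h2.preimage continuous_prodSpace_snd)

lemma measurePreserving_finiteCylinder (hU : MeasurableSet (ℓ • U)) (h2 : MeasurableSet ω₂) :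
    MeasurePreserving (MeasurableEquiv.toLp 2 (EuclideanSpace ℝ (Fin m) ×
      EuclideanSpace ℝ (Fin k))).symm (volume.restrict (finiteCylinder U ω₂ ℓ))
      ((volume.restrict (ℓ • U)).prod (volume.restrict ω₂)) := by
  rw [Measure.prod_restrict]
  exact (WithLp.volume_preserving_symm_measurableEquiv_toLp_prod _ _).restrict_preimage
    (hU.prod h2)

lemma setIntegral_finiteCylinder {F : Type*} [NormedAddCommGroup F] [NormedSpace ℝ F]
    (hU : MeasurableSet (ℓ • U)) (h2 : MeasurableSet ω₂) (h : ProdSpace m k → F) :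
    ∫ x in finiteCylinder U ω₂ ℓ, h x =
      ∫ z, h (WithLp.toLp 2 z) ∂((volume.restrict (ℓ • U)).prod (volume.restrict ω₂)) := by
  rw [← (measurePreserving_finiteCylinder hU h2).integral_comp'
    (fun z => h (WithLp.toLp 2 z))]
  rfl

lemma integrable_prod_of_finiteCylinder {F : Type*} [NormedAddCommGroup F]
    (hU : MeasurableSet (ℓ • U)) (h2 : MeasurableSet ω₂) {h : ProdSpace m k → F}
    (hi : IntegrableOn h (finiteCylinder U ω₂ ℓ)) :
    Integrable (fun z => h (WithLp.toLp 2 z))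
      ((volume.restrict (ℓ • U)).prod (volume.restrict ω₂)) := by
  rw [← (measurePreserving_finiteCylinder hU h2).integrable_comp_emb
    (MeasurableEquiv.measurableEmbedding _)]
  exact hi

lemma map_snd_finiteCylinder (hU : MeasurableSet (ℓ • U)) (h2 : MeasurableSet ω₂) :
    Measure.map (fun x : ProdSpace m k => x.snd) (volume.restrict (finiteCylinder U ω₂ ℓ)) =
      volume (ℓ • U) • volume.restrict ω₂ := by
  have h := (measurePreserving_finiteCylinder (k := k) hU h2).map_eq
  have e : (fun x : ProdSpace m k => x.snd) = Prod.snd ∘ (MeasurableEquiv.toLp 2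
    (EuclideanSpace ℝ (Fin m) × EuclideanSpace ℝ (Fin k))).symm := rfl
  rw [e, ← Measure.map_map measurable_snd (MeasurableEquiv.measurable _), h, Measure.map_snd_prod,
    Measure.restrict_apply_univ]

lemma volume_smul_set (hℓ : 0 ≤ ℓ) :
    volume (ℓ • U) = ENNReal.ofReal (ℓ ^ m) * volume U := by
  rw [Measure.addHaar_smul, finrank_euclideanSpace, Fintype.card_fin, abs_of_nonneg (by positivity)]

section Extension

variable {F : Type*} [NormedAddCommGroup F]

lemma aestronglyMeasurable_comp_snd (hU : MeasurableSet (ℓ • U)) (h2 : MeasurableSet ω₂)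
    {h : EuclideanSpace ℝ (Fin k) → F} (hh : AEStronglyMeasurable h (volume.restrict ω₂)) :
    AEStronglyMeasurable (fun x : ProdSpace m k => h x.snd)
      (volume.restrict (finiteCylinder U ω₂ ℓ)) := by
  have h1 : AEStronglyMeasurable h (Measure.map (fun x : ProdSpace m k => x.snd)
      (volume.restrict (finiteCylinder U ω₂ ℓ))) := by
    rw [map_snd_finiteCylinder hU h2]
    exact hh.smul_measure _
  exact h1.comp_measurable continuous_prodSpace_snd.measurable

lemma eLpNorm_comp_snd (hU : MeasurableSet (ℓ • U)) (h2 : MeasurableSet ω₂) {P : ℝ≥0∞}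
    (hP : P ≠ ⊤) {h : EuclideanSpace ℝ (Fin k) → F}
    (hh : AEStronglyMeasurable h (volume.restrict ω₂)) :
    eLpNorm (fun x : ProdSpace m k => h x.snd) P (volume.restrict (finiteCylinder U ω₂ ℓ)) =
      volume (ℓ • U) ^ (1 / P).toReal * eLpNorm h P (volume.restrict ω₂) := by
  have h1 : AEStronglyMeasurable h (Measure.map (fun x : ProdSpace m k => x.snd)
      (volume.restrict (finiteCylinder U ω₂ ℓ))) := by
    rw [map_snd_finiteCylinder hU h2]
    exact hh.smul_measure _
  have h3 := eLpNorm_map_measure (p := P) h1 continuous_prodSpace_snd.aemeasurable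
  rw [map_snd_finiteCylinder hU h2, eLpNorm_smul_measure_of_ne_top hP, smul_eq_mul] at h3
  exact h3.symm

lemma memLp_comp_snd (hU : MeasurableSet (ℓ • U)) (hUf : volume (ℓ • U) ≠ ⊤)
    (h2 : MeasurableSet ω₂) {P : ℝ≥0∞} (hP : P ≠ ⊤) {h : EuclideanSpace ℝ (Fin k) → F}
    (hh : MemLp h P (volume.restrict ω₂)) :
    MemLp (fun x : ProdSpace m k => h x.snd) P (volume.restrict (finiteCylinder U ω₂ ℓ)) := by
  refine ⟨aestronglyMeasurable_comp_snd hU h2 hh.1, ?_⟩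
  rw [eLpNorm_comp_snd hU h2 hP hh.1]
  exact ENNReal.mul_lt_top (ENNReal.rpow_lt_top_of_nonneg ENNReal.toReal_nonneg hUf) hh.2

lemma setIntegral_comp_snd [NormedSpace ℝ F] (hU : MeasurableSet (ℓ • U)) (h2 : MeasurableSet ω₂)
    {h : EuclideanSpace ℝ (Fin k) → F} (hh : AEStronglyMeasurable h (volume.restrict ω₂)) :
    ∫ x in finiteCylinder U ω₂ ℓ, h x.snd = (volume (ℓ • U)).toReal • ∫ y in ω₂, h y := by
  have h1 : AEStronglyMeasurable h (Measure.map (fun x : ProdSpace m k => x.snd)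
      (volume.restrict (finiteCylinder U ω₂ ℓ))) := by
    rw [map_snd_finiteCylinder hU h2]
    exact hh.smul_measure _
  have h3 := integral_map continuous_prodSpace_snd.aemeasurable h1
  rw [map_snd_finiteCylinder hU h2, integral_smul_measure] at h3
  exact h3.symm

end Extension

lemma SmoothApprox.comp_snd (hU : MeasurableSet (ℓ • U)) (hUf : volume (ℓ • U) ≠ ⊤)
    (h2 : MeasurableSet ω₂) {p : ℝ} {u : EuclideanSpace ℝ (Fin k) → ℝ}
    {g : EuclideanSpace ℝ (Fin k) → EuclideanSpace ℝ (Fin k)}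
    {ψ : ℕ → EuclideanSpace ℝ (Fin k) → ℝ} (h : SmoothApprox p ω₂ u g ψ) :
    SmoothApprox p (finiteCylinder U ω₂ ℓ) (fun x => u x.snd)
      (fun x => WithLp.toLp 2 (0, g x.snd)) (fun j x => ψ j x.snd) := by
  have hP : ENNReal.ofReal p ≠ ⊤ := ENNReal.ofReal_ne_top
  have hc : volume (ℓ • U) ^ (1 / ENNReal.ofReal p).toReal ≠ ⊤ :=
    (ENNReal.rpow_lt_top_of_nonneg ENNReal.toReal_nonneg hUf).ne
  refine ⟨fun j => (h.contDiff j).comp (sndCLM m k).contDiff,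
    memLp_comp_snd hU hUf h2 hP h.memLp,
    memLp_comp_snd (h := fun y => inrCLM m k (g y)) hU hUf h2 hP
      ((inrCLM m k).comp_memLp' h.memLp_grad), ?_, ?_⟩
  · have lim := ENNReal.Tendsto.const_mul h.tendsto (.inr hc)
    rw [mul_zero] at lim
    refine lim.congr fun j => ?_
    rw [← eLpNorm_comp_snd (h := fun y => ψ j y - u y) hU h2 hP ((h.aesm j).sub h.memLp.1)]
  · have lim := ENNReal.Tendsto.const_mul h.tendsto_grad (.inr hc)
    rw [mul_zero] at lim
    refine lim.congr fun j => ?_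
    rw [← eLpNorm_comp_snd (h := fun y => gradient (ψ j) y - g y) hU h2 hP
      ((h.aesm_grad j).sub h.memLp_grad.1)]
    refine eLpNorm_congr_norm_ae (.of_forall fun x => ?_)
    rw [gradient_comp_snd ((h.contDiff j).differentiable (by simp)), ← inrCLM_apply,
      ← inrCLM_apply, ← map_sub, inrCLM_apply, WithLp.norm_toLp_snd]

/-- A weak equation on the cross-section extends to the cylinder: the longitudinal part of a field
that does not depend on `X₁` is orthogonal to the gradients of test functions, and the slices of a
test function are test functions on the cross-section. -/
lemma IsTestFunction.integral_cylinder_eq (hU : MeasurableSet (ℓ • U))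
    (hUf : volume (ℓ • U) ≠ ⊤) (h2 : MeasurableSet ω₂) {q : ℝ} (hq : 1 < q)
    {V : EuclideanSpace ℝ (Fin k) → ProdSpace m k} {f : EuclideanSpace ℝ (Fin k) → ℝ}
    (hV : MemLp V (ENNReal.ofReal q) (volume.restrict ω₂))
    (hf : MemLp f (ENNReal.ofReal q) (volume.restrict ω₂))
    (h : ∀ χ, IsTestFunction ω₂ χ → ∫ y in ω₂, ⟪(V y).snd, gradient χ y⟫ = ∫ y in ω₂, f y * χ y)
    {φ : ProdSpace m k → ℝ} (hφ : IsTestFunction (finiteCylinder U ω₂ ℓ) φ) :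
    ∫ x in finiteCylinder U ω₂ ℓ, ⟪V x.snd, gradient φ x⟫ =
      ∫ x in finiteCylinder U ω₂ ℓ, f x.snd * φ x := by
  have hconj := (Real.HolderConjugate.conjExponent hq).ennrealOfReal
  have hP : ENNReal.ofReal q ≠ ⊤ := ENNReal.ofReal_ne_top
  have hφd : Differentiable ℝ φ := hφ.1.differentiable (by simp)
  have hgr : MemLp (gradient φ) (ENNReal.ofReal q.conjExponent)
      (volume.restrict (finiteCylinder U ω₂ ℓ)) := hφ.memLp_gradient _ _
  have i1 : IntegrableOn (fun x : ProdSpace m k => ⟪(V x.snd).fst, (gradient φ x).fst⟫)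
      (finiteCylinder U ω₂ ℓ) := by
    refine memLp_one_iff_integrable.1 (MemLp.of_bilin (r := 1) (fun a b => ⟪a, b⟫) 1
      (memLp_comp_snd (h := fun y => (V y).fst) hU hUf h2 hP ((fstCLM m k).comp_memLp' hV))
      ((fstCLM m k).comp_memLp' hgr) ?_ (.of_forall fun x => ?_))
    · exact (aestronglyMeasurable_comp_snd (h := fun y => (V y).fst) hU h2
        ((fstCLM m k).comp_memLp' hV).1).inner ((fstCLM m k).comp_memLp' hgr).1
    · rw [one_mul]; exact nnnorm_inner_le_nnnorm _ _
  have i2 : IntegrableOn (fun x : ProdSpace m k => ⟪(V x.snd).snd, (gradient φ x).snd⟫)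
      (finiteCylinder U ω₂ ℓ) := by
    refine memLp_one_iff_integrable.1 (MemLp.of_bilin (r := 1) (fun a b => ⟪a, b⟫) 1
      (memLp_comp_snd (h := fun y => (V y).snd) hU hUf h2 hP ((sndCLM m k).comp_memLp' hV))
      ((sndCLM m k).comp_memLp' hgr) ?_ (.of_forall fun x => ?_))
    · exact (aestronglyMeasurable_comp_snd (h := fun y => (V y).snd) hU h2
        ((sndCLM m k).comp_memLp' hV).1).inner ((sndCLM m k).comp_memLp' hgr).1
    · rw [one_mul]; exact nnnorm_inner_le_nnnorm _ _
  have i3 : IntegrableOn (fun x : ProdSpace m k => f x.snd * φ x) (finiteCylinder U ω₂ ℓ) :=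
    (memLp_comp_snd hU hUf h2 hP hf).integrable_mul (hφ.memLp (ENNReal.ofReal q.conjExponent) _)
  simp only [inner_prodSpace]
  rw [integral_add i1 i2, setIntegral_finiteCylinder hU h2, setIntegral_finiteCylinder hU h2,
    setIntegral_finiteCylinder hU h2,
    integral_prod_symm _ (integrable_prod_of_finiteCylinder hU h2 i1),
    integral_prod _ (integrable_prod_of_finiteCylinder hU h2 i2),
    integral_prod _ (integrable_prod_of_finiteCylinder hU h2 i3)]
  have z1 : ∀ b, ∫ a in ℓ • U, ⟪(V b).fst, (gradient φ (WithLp.toLp 2 (a, b))).fst⟫ = 0 := by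
    intro b
    have hd : ContDiff ℝ ∞ fun a => φ (WithLp.toLp 2 (a, b)) := hφ.1.comp (contDiff_toLp_left b)
    have hc := hasCompactSupport_slice_left hφ.2.1 b
    rw [setIntegral_eq_integral_of_forall_compl_eq_zero fun a ha => by
      have hz : gradient φ (WithLp.toLp 2 (a, b)) = 0 := hφ.gradient_eq_zero fun h' => ha h'.1
      rw [hz]
      exact inner_zero_right _]
    simp only [← gradient_slice_left hφd]
    rw [integral_inner (f := gradient fun a => φ (WithLp.toLp 2 (a, b)))
        ((hd.continuous_gradient (by simp)).integrable_of_hasCompactSupport hc.gradient),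
      integral_gradient_eq_zero (hd.of_le (by simp)) hc, inner_zero_right]
  refine (congrArg₂ (· + ·) (integral_eq_zero_of_ae (.of_forall z1)) ?_).trans (zero_add _)
  refine integral_congr_ae (.of_forall fun a => ?_)
  have h3 := h _ (hφ.slice_right a)
  simp only [gradient_slice_right hφd] at h3
  exact h3

end Cylinder

/-! ### Hölder's inequality and the absorption argument -/

section Absorption

variable {α : Type*} [MeasurableSpace α] {μ : Measure α}

lemma memLp_rpow_of_integrable {f : α → ℝ} (hf0 : ∀ x, 0 ≤ f x) (hf : Integrable f μ) {s : ℝ}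
    (hs : 0 < s) : MemLp (fun x => f x ^ s) (ENNReal.ofReal (1 / s)) μ := by
  have hm : AEStronglyMeasurable (fun x => f x ^ s) μ :=
    (hf.aemeasurable.pow_const s).aestronglyMeasurable
  rw [← integrable_norm_rpow_iff hm (by simpa using hs) ENNReal.ofReal_ne_top,
    ENNReal.toReal_ofReal (by positivity)]
  refine hf.congr (.of_forall fun x => ?_)
  simp only
  rw [Real.norm_of_nonneg (Real.rpow_nonneg (hf0 x) _), ← Real.rpow_mul (hf0 x),
    mul_one_div_cancel hs.ne', Real.rpow_one]

/-- Hölder's inequality for two nonnegative integrable functions. -/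
lemma integral_rpow_mul_rpow_le {f g : α → ℝ} (hf0 : ∀ x, 0 ≤ f x) (hg0 : ∀ x, 0 ≤ g x)
    (hf : Integrable f μ) (hg : Integrable g μ) {s : ℝ} (hs : 0 < s) (hs1 : s < 1) :
    Integrable (fun x => f x ^ s * g x ^ (1 - s)) μ ∧
      ∫ x, f x ^ s * g x ^ (1 - s) ∂μ ≤ (∫ x, f x ∂μ) ^ s * (∫ x, g x ∂μ) ^ (1 - s) := by
  have hs2 : 0 < 1 - s := by linarith
  have hc : (1 / s).HolderConjugate (1 / (1 - s)) := by
    rw [one_div, one_div, Real.holderConjugate_iff]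
    refine ⟨(one_lt_inv₀ hs).2 hs1, ?_⟩
    simp
  have hce := hc.ennrealOfReal
  have m1 := memLp_rpow_of_integrable hf0 hf hs
  have m2 := memLp_rpow_of_integrable hg0 hg hs2
  refine ⟨m1.integrable_mul m2, ?_⟩
  have h := integral_mul_le_Lp_mul_Lq_of_nonneg hc
    (.of_forall fun x => Real.rpow_nonneg (hf0 x) s)
    (.of_forall fun x => Real.rpow_nonneg (hg0 x) (1 - s)) m1 m2
  have e1 : ∀ x, (f x ^ s) ^ (1 / s) = f x := fun x => by
    rw [← Real.rpow_mul (hf0 x), mul_one_div_cancel hs.ne', Real.rpow_one]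
  have e2 : ∀ x, (g x ^ (1 - s)) ^ (1 / (1 - s)) = g x := fun x => by
    rw [← Real.rpow_mul (hg0 x), mul_one_div_cancel hs2.ne', Real.rpow_one]
  simpa only [e1, e2, one_div_one_div] using h

lemma MeasureTheory.MemLp.integrable_norm_rpow_ofReal {F : Type*} [NormedAddCommGroup F] {p : ℝ}
    (hp : 0 < p) {u : α → F} (hu : MemLp u (ENNReal.ofReal p) μ) :
    Integrable (fun x => ‖u x‖ ^ p) μ := by
  simpa [ENNReal.toReal_ofReal hp.le] using
    hu.integrable_norm_rpow (by simpa using hp) ENNReal.ofReal_ne_top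

lemma integrable_rpow_mul_of_le_one {p : ℝ} (hp : 0 < p) {F : Type*} [NormedAddCommGroup F]
    {u : α → F} (hu : MemLp u (ENNReal.ofReal p) μ) {η : α → ℝ} (hη : AEStronglyMeasurable η μ)
    (h0 : ∀ x, 0 ≤ η x) (h1 : ∀ x, η x ≤ 1) : Integrable (fun x => (η x * ‖u x‖) ^ p) μ := by
  refine (hu.integrable_norm_rpow_ofReal hp).mono'
    ((hη.mul hu.1.norm).aemeasurable.pow_const p).aestronglyMeasurable (.of_forall fun x => ?_)
  have := h0 x
  rw [Real.norm_of_nonneg (by positivity)]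
  exact Real.rpow_le_rpow (by positivity) (mul_le_of_le_one_left (norm_nonneg _) (h1 x)) hp.le

variable {E : Type*} [NormedAddCommGroup E] [InnerProductSpace ℝ E]

/-- The weight `η ^ 2` suffices for `p ≥ 2`, since then `η ^ p ≤ η ^ 2`. -/
lemma integral_sq_mul_le_of_two_le {p : ℝ} (hp : 2 ≤ p) {D G : α → E} {w η : α → ℝ}
    (hD : MemLp D (ENNReal.ofReal (p / (p - 1))) μ) (hG : MemLp G (ENNReal.ofReal p) μ)
    (hw : MemLp w (ENNReal.ofReal p) μ) (hη : AEStronglyMeasurable η μ) (h0 : ∀ x, 0 ≤ η x)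
    (h1 : ∀ x, η x ≤ 1) {b B c : ℝ} (hb : 0 ≤ b) (hB : 0 ≤ B) (hc : 0 < c)
    (hmon : ∀ x, c * ‖G x‖ ^ p ≤ ⟪D x, G x⟫)
    (hen : ∫ x, η x ^ 2 * ⟪D x, G x⟫ ∂μ ≤ b * ∫ x, ‖D x‖ * (η x * ‖w x‖) ∂μ)
    (hpoin : (∫ x, (η x * ‖w x‖) ^ p ∂μ) ^ (1 / p) ≤
      B * (∫ x, (η x * ‖G x‖) ^ p ∂μ) ^ (1 / p)) :
    ∫ x, η x ^ 2 * ‖G x‖ ^ p ∂μ ≤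
      (b * B / c) ^ (p / (p - 1)) * ∫ x, ‖D x‖ ^ (p / (p - 1)) ∂μ := by
  have hp0 : 0 < p := by linarith
  have hp1 : 0 < p - 1 := by linarith
  have hq0 : 0 < p / (p - 1) := by positivity
  have hconj := (Real.HolderConjugate.conjExponent (by linarith : 1 < p)).symm.ennrealOfReal
  rw [Real.conjExponent] at hconj
  have iD := hD.integrable_norm_rpow_ofReal hq0
  have iw := integrable_rpow_mul_of_le_one hp0 hw hη h0 h1
  have iG := integrable_rpow_mul_of_le_one hp0 hG hη h0 h1
  have hs : 0 < (p - 1) / p := by positivity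
  have hs1 : (p - 1) / p < 1 := by rw [div_lt_one hp0]; linarith
  have hs2 : 1 - (p - 1) / p = 1 / p := by field_simp; ring
  obtain ⟨-, hH⟩ := integral_rpow_mul_rpow_le (μ := μ) (f := fun x => ‖D x‖ ^ (p / (p - 1)))
    (g := fun x => (η x * ‖w x‖) ^ p) (fun x => by positivity)
    (fun x => by have := h0 x; positivity) iD iw hs hs1
  have e1 : ∀ x, (‖D x‖ ^ (p / (p - 1))) ^ ((p - 1) / p) * ((η x * ‖w x‖) ^ p) ^ (1 - (p - 1) / p)
      = ‖D x‖ * (η x * ‖w x‖) := fun x => by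
    have := h0 x
    rw [hs2, ← Real.rpow_mul (norm_nonneg _), ← Real.rpow_mul (by positivity),
      mul_one_div_cancel hp0.ne', div_mul_div_cancel₀ hp1.ne', div_self hp0.ne', Real.rpow_one,
      Real.rpow_one]
  simp only [e1] at hH
  have iη : Integrable (fun x => η x ^ 2 * ‖G x‖ ^ p) μ := by
    refine (hG.integrable_norm_rpow_ofReal hp0).mono'
      ((hη.pow 2).mul (hG.integrable_norm_rpow_ofReal hp0).1) (.of_forall fun x => ?_)
    rw [Real.norm_of_nonneg (by positivity)]
    exact mul_le_of_le_one_left (by positivity) (pow_le_one₀ (h0 x) (h1 x))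
  have iDG : Integrable (fun x => η x ^ 2 * ⟪D x, G x⟫) μ := by
    have hi : Integrable (fun x => ‖D x‖ * ‖G x‖) μ := hD.norm.integrable_mul hG.norm
    refine hi.mono' ((hη.pow 2).mul (hD.1.inner hG.1)) (.of_forall fun x => ?_)
    rw [norm_mul, Real.norm_of_nonneg (by positivity)]
    exact (mul_le_of_le_one_left (norm_nonneg _) (pow_le_one₀ (h0 x) (h1 x))).trans
      (norm_inner_le_norm _ _)
  have hX : c * ∫ x, η x ^ 2 * ‖G x‖ ^ p ∂μ ≤ ∫ x, η x ^ 2 * ⟪D x, G x⟫ ∂μ := by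
    rw [← integral_const_mul]
    refine integral_mono (iη.const_mul c) iDG fun x => ?_
    have := mul_le_mul_of_nonneg_left (hmon x) (by positivity : 0 ≤ η x ^ 2)
    simp only
    linarith
  have hGX : ∫ x, (η x * ‖G x‖) ^ p ∂μ ≤ ∫ x, η x ^ 2 * ‖G x‖ ^ p ∂μ := by
    refine integral_mono iG iη fun x => ?_
    simp only
    rw [Real.mul_rpow (h0 x) (norm_nonneg _)]
    refine mul_le_mul_of_nonneg_right ?_ (by positivity)
    rcases (h0 x).eq_or_lt with h | h
    · rw [← h, Real.zero_rpow hp0.ne']; simp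
    · have := Real.rpow_le_rpow_of_exponent_ge h (h1 x) hp
      simpa using this
  have n1 : 0 ≤ ∫ x, η x ^ 2 * ‖G x‖ ^ p ∂μ := integral_nonneg fun x => by positivity
  have n2 : 0 ≤ ∫ x, ‖D x‖ ^ (p / (p - 1)) ∂μ := integral_nonneg fun x => by positivity
  have n3 : 0 ≤ ∫ x, (η x * ‖G x‖) ^ p ∂μ :=
    integral_nonneg fun x => by have := h0 x; positivity
  have key := le_rpow_mul_of_le_mul_rpow (b := b * B / c) n1 (by positivity) n2 hs (by
    rw [hs2] at hH ⊢
    rw [← mul_le_mul_iff_right₀ hc]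
    calc _ ≤ _ := hX
      _ ≤ _ := hen
      _ ≤ b * ((∫ x, ‖D x‖ ^ (p / (p - 1)) ∂μ) ^ ((p - 1) / p) *
            (B * (∫ x, η x ^ 2 * ‖G x‖ ^ p ∂μ) ^ (1 / p))) := by
          refine mul_le_mul_of_nonneg_left (hH.trans ?_) hb
          refine mul_le_mul_of_nonneg_left (hpoin.trans ?_) (by positivity)
          exact mul_le_mul_of_nonneg_left (Real.rpow_le_rpow n3 hGX (by positivity)) hB
      _ = _ := by field_simp)
  rwa [one_div_div] at key

lemma mul_rpow_sub_two_le {p t s : ℝ} (hp : 1 < p) (hp2 : p < 2) (ht : 0 ≤ t) (hts : t ≤ s) :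
    t * s ^ (p - 2) ≤ (t ^ 2 * s ^ (p - 2)) ^ ((p - 1) / p) := by
  have hp0 : 0 < p := by linarith
  rcases ht.eq_or_lt with rfl | ht'
  · rw [zero_mul]
    positivity
  have hs' : 0 < s := ht'.trans_le hts
  have e1 : t = t ^ (2 * (p - 1) / p) * t ^ ((2 - p) / p) := by
    rw [← Real.rpow_add ht', ← add_div]
    ring_nf
    rw [mul_inv_cancel₀ hp0.ne', Real.rpow_one]
  have e2 : (t ^ 2 * s ^ (p - 2)) ^ ((p - 1) / p) =
      t ^ (2 * (p - 1) / p) * s ^ ((p - 2) * ((p - 1) / p)) := by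
    rw [Real.mul_rpow (by positivity) (by positivity), ← Real.rpow_mul hs'.le,
      ← Real.rpow_natCast t 2, ← Real.rpow_mul ht]
    congr 2
    push_cast
    ring
  have e3 : s ^ ((p - 2) * ((p - 1) / p)) = s ^ ((2 - p) / p) * s ^ (p - 2) := by
    rw [← Real.rpow_add hs']
    congr 1
    field_simp
    ring
  rw [e2, e3]
  nth_rewrite 1 [e1]
  rw [mul_assoc]
  gcongr

lemma rpow_eq_mul_rpow_sub_two {p t s : ℝ} (hp : 1 < p) (ht : 0 ≤ t) (hts : t ≤ s) :
    t ^ p = (t ^ 2 * s ^ (p - 2)) ^ (p / 2) * (s ^ p) ^ (1 - p / 2) := by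
  have hp0 : 0 < p := by linarith
  rcases ht.eq_or_lt with rfl | ht'
  · rw [Real.zero_rpow hp0.ne']
    simp [Real.zero_rpow (by positivity : p / 2 ≠ 0)]
  have hs' : 0 < s := ht'.trans_le hts
  rw [Real.mul_rpow (by positivity) (by positivity), ← Real.rpow_mul hs'.le,
    ← Real.rpow_natCast t 2, ← Real.rpow_mul ht, ← Real.rpow_mul hs'.le, mul_assoc,
    ← Real.rpow_add hs']
  have e : (p - 2) * (p / 2) + p * (1 - p / 2) = 0 := by ring
  rw [e, Real.rpow_zero, mul_one]
  congr 1
  push_cast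
  ring

/-- For `1 < p < 2` the monotonicity degenerates where `S` is large. The energy
`Y = ∫ η ^ (2 a) ‖G‖ ^ 2 S ^ (p - 2)` controls `Z = ∫ (η ^ a ‖G‖) ^ p` by Hölder's inequality,
`Z ≤ Y ^ (p / 2) (∫ S ^ p) ^ (1 - p / 2)`, and `Y ≤ C Y ^ (1 - 1 / p) Z ^ (1 / p)`; the condition
on `a` makes the weights match. -/
lemma integral_pow_mul_le_of_lt_two {p : ℝ} (hp : 1 < p) (hp2 : p < 2) {D G : α → E}
    {w η S : α → ℝ} {a : ℕ} (ha : p / (2 - p) ≤ a)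
    (hD : MemLp D (ENNReal.ofReal (p / (p - 1))) μ) (hG : MemLp G (ENNReal.ofReal p) μ)
    (hw : MemLp w (ENNReal.ofReal p) μ) (hη : AEStronglyMeasurable η μ) (h0 : ∀ x, 0 ≤ η x)
    (h1 : ∀ x, η x ≤ 1) (hS : MemLp S (ENNReal.ofReal p) μ) (hGS : ∀ x, ‖G x‖ ≤ S x)
    {b B c c' : ℝ} (hb : 0 ≤ b) (hB : 0 ≤ B) (hc : 0 < c) (hc' : 0 ≤ c')
    (hmon : ∀ x, c * (‖G x‖ ^ 2 * S x ^ (p - 2)) ≤ ⟪D x, G x⟫)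
    (hlip : ∀ x, ‖D x‖ ≤ c' * (‖G x‖ * S x ^ (p - 2)))
    (hen : ∫ x, η x ^ (2 * a) * ⟪D x, G x⟫ ∂μ ≤
      b * ∫ x, ‖D x‖ * (η x ^ (2 * a - 1) * ‖w x‖) ∂μ)
    (hpoin : (∫ x, (η x ^ a * ‖w x‖) ^ p ∂μ) ^ (1 / p) ≤
      B * (∫ x, (η x ^ a * ‖G x‖) ^ p ∂μ) ^ (1 / p)) :
    ∫ x, (η x ^ a * ‖G x‖) ^ p ∂μ ≤
      (b * c' * B / c) ^ (p ^ 2 / (2 - p)) * ∫ x, S x ^ p ∂μ := by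
  have hp0 : 0 < p := by linarith
  have hp1 : 0 < p - 1 := by linarith
  have hp3 : 0 < 2 - p := by linarith
  have hS0 : ∀ x, 0 ≤ S x := fun x => (norm_nonneg _).trans (hGS x)
  have ha0 : (0 : ℝ) < a := lt_of_lt_of_le (by positivity) ha
  have ha1 : 1 ≤ a := by exact_mod_cast ha0
  have hconj := (Real.HolderConjugate.conjExponent hp).symm.ennrealOfReal
  rw [Real.conjExponent] at hconj
  have hηa : AEStronglyMeasurable (fun x => η x ^ a) μ := hη.pow a
  have hηa0 : ∀ x, 0 ≤ η x ^ a := fun x => pow_nonneg (h0 x) a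
  have hηa1 : ∀ x, η x ^ a ≤ 1 := fun x => pow_le_one₀ (h0 x) (h1 x)
  have iw := integrable_rpow_mul_of_le_one hp0 hw hηa hηa0 hηa1
  have iS : Integrable (fun x => S x ^ p) μ :=
    (hS.integrable_norm_rpow_ofReal hp0).congr (.of_forall fun x => by
      simp only [Real.norm_of_nonneg (hS0 x)])
  -- The weighted energy density.
  set T : α → ℝ := fun x => η x ^ (2 * a) * (‖G x‖ ^ 2 * S x ^ (p - 2)) with hT
  have T0 : ∀ x, 0 ≤ T x := fun x => by
    have := h0 x; have := hS0 x; positivity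
  have iT : Integrable T μ := by
    refine iS.mono' ((hη.pow _).mul ((hG.1.norm.pow 2).mul
      (hS.1.aemeasurable.pow_const _).aestronglyMeasurable)) (.of_forall fun x => ?_)
    rw [Real.norm_of_nonneg (T0 x)]
    have h2 : ‖G x‖ ^ 2 * S x ^ (p - 2) ≤ S x ^ p := by
      rcases (hS0 x).eq_or_lt with h | h
      · have : ‖G x‖ = 0 := le_antisymm (h ▸ hGS x) (norm_nonneg _)
        rw [this]
        have := hS0 x
        simp only [ne_eq, OfNat.ofNat_ne_zero, not_false_eq_true, zero_pow, zero_mul]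
        positivity
      · calc ‖G x‖ ^ 2 * S x ^ (p - 2) ≤ S x ^ 2 * S x ^ (p - 2) := by
              gcongr
              exact hGS x
          _ = S x ^ p := by
              rw [← Real.rpow_natCast, ← Real.rpow_add h]
              norm_num
    have := hS0 x
    exact (mul_le_of_le_one_left (by positivity) (pow_le_one₀ (h0 x) (h1 x))).trans h2
  have hs : 0 < (p - 1) / p := by positivity
  have hs1 : (p - 1) / p < 1 := by rw [div_lt_one hp0]; linarith
  have hs2 : 1 - (p - 1) / p = 1 / p := by field_simp; ring
  obtain ⟨iH1, hH1⟩ := integral_rpow_mul_rpow_le (μ := μ) (f := T)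
    (g := fun x => (η x ^ a * ‖w x‖) ^ p) T0 (fun x => by have := h0 x; positivity) iT iw hs hs1
  obtain ⟨iH2, hH2⟩ := integral_rpow_mul_rpow_le (μ := μ) (f := T) (g := fun x => S x ^ p) T0
    (fun x => by have := hS0 x; positivity) iT iS (by positivity : 0 < p / 2) (by linarith)
  have hZ : ∫ x, (η x ^ a * ‖G x‖) ^ p ∂μ ≤
      (∫ x, T x ∂μ) ^ (p / 2) * (∫ x, S x ^ p ∂μ) ^ (1 - p / 2) := by
    refine le_trans (le_of_eq (integral_congr_ae (.of_forall fun x => ?_))) hH2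
    simp only [hT]
    rw [Real.mul_rpow (hηa0 x) (norm_nonneg _),
      rpow_eq_mul_rpow_sub_two hp (norm_nonneg _) (hGS x), ← mul_assoc,
      Real.mul_rpow (x := η x ^ (2 * a)) (by have := h0 x; positivity)
        (by have := hS0 x; positivity), mul_comm 2 a, pow_mul, ← Real.rpow_natCast (η x ^ a) 2,
      ← Real.rpow_mul (hηa0 x)]
    norm_num [mul_div_cancel₀]
  have iDG : Integrable (fun x => η x ^ (2 * a) * ⟪D x, G x⟫) μ := by
    have hi : Integrable (fun x => ‖D x‖ * ‖G x‖) μ := hD.norm.integrable_mul hG.norm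
    refine hi.mono' ((hη.pow _).mul (hD.1.inner hG.1)) (.of_forall fun x => ?_)
    rw [norm_mul, Real.norm_of_nonneg (by have := h0 x; positivity)]
    exact (mul_le_of_le_one_left (norm_nonneg _) (pow_le_one₀ (h0 x) (h1 x))).trans
      (norm_inner_le_norm _ _)
  have hY : c * ∫ x, T x ∂μ ≤ ∫ x, η x ^ (2 * a) * ⟪D x, G x⟫ ∂μ := by
    rw [← integral_const_mul]
    refine integral_mono (iT.const_mul c) iDG fun x => ?_
    have := mul_le_mul_of_nonneg_left (hmon x) (pow_nonneg (h0 x) (2 * a))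
    simp only [hT]
    linarith
  have hDw : ∫ x, ‖D x‖ * (η x ^ (2 * a - 1) * ‖w x‖) ∂μ ≤
      c' * ((∫ x, T x ∂μ) ^ ((p - 1) / p) * (∫ x, (η x ^ a * ‖w x‖) ^ p ∂μ) ^ (1 / p)) := by
    rw [hs2] at hH1 iH1
    refine le_trans ?_ (mul_le_mul_of_nonneg_left hH1 hc')
    rw [← integral_const_mul]
    refine integral_mono_of_nonneg (.of_forall fun x => by have := h0 x; positivity)
      (iH1.const_mul c') (.of_forall fun x => ?_)
    simp only [hT]
    have hx0 := h0 x
    have hx1 := hS0 x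
    -- `η ^ (2 a - 1) ≤ η ^ (2 a (p - 1) / p) η ^ a` by the choice of `a`.
    have hw1 : η x ^ (2 * a - 1) ≤ (η x ^ (2 * a)) ^ ((p - 1) / p) * η x ^ a := by
      rcases hx0.eq_or_lt with h | h
      · rw [← h, zero_pow (by omega)]
        positivity
      · rw [← Real.rpow_natCast, ← Real.rpow_natCast (η x) (2 * a), ← Real.rpow_natCast (η x) a,
          ← Real.rpow_mul hx0, ← Real.rpow_add h]
        refine Real.rpow_le_rpow_of_exponent_ge h (h1 x) ?_
        rw [Nat.cast_sub (by omega)]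
        push_cast
        rw [div_le_iff₀ hp3] at ha
        have e : 2 * (a : ℝ) - 1 - (2 * a * ((p - 1) / p) + a) = (a * (2 - p) - p) / p := by
          field_simp
          ring
        have : 0 ≤ (a * (2 - p) - p) / p := div_nonneg (by linarith) hp0.le
        linarith
    calc ‖D x‖ * (η x ^ (2 * a - 1) * ‖w x‖)
        ≤ (c' * (‖G x‖ ^ 2 * S x ^ (p - 2)) ^ ((p - 1) / p)) *
          (((η x ^ (2 * a)) ^ ((p - 1) / p) * η x ^ a) * ‖w x‖) := by
          gcongr
          exact (hlip x).trans (mul_le_mul_of_nonneg_left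
            (mul_rpow_sub_two_le hp hp2 (norm_nonneg _) (hGS x)) hc')
      _ = _ := by
          rw [← Real.rpow_mul (by positivity), mul_one_div_cancel hp0.ne', Real.rpow_one,
            Real.mul_rpow (x := η x ^ (2 * a)) (by positivity) (by positivity)]
          ring
  have nT : 0 ≤ ∫ x, T x ∂μ := integral_nonneg T0
  have nS : 0 ≤ ∫ x, S x ^ p ∂μ := integral_nonneg fun x => by have := hS0 x; positivity
  have nZ : 0 ≤ ∫ x, (η x ^ a * ‖G x‖) ^ p ∂μ :=
    integral_nonneg fun x => by have := h0 x; positivity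
  set Y := ∫ x, T x ∂μ
  set M := ∫ x, S x ^ p ∂μ
  set b' := b * c' * B / c with hb'
  have hb'0 : 0 ≤ b' := by positivity
  have hsplit : (Y ^ (p / 2) * M ^ (1 - p / 2)) ^ (1 / p) =
      Y ^ (1 / 2 : ℝ) * M ^ ((2 - p) / (2 * p)) := by
    rw [Real.mul_rpow (by positivity) (by positivity), ← Real.rpow_mul nT, ← Real.rpow_mul nS]
    congr 2 <;> field_simp
  have key := le_rpow_mul_of_le_mul_rpow (X := Y) (b := b') (M := M) (s := (2 - p) / (2 * p))
    nT hb'0 nS (by positivity) (by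
    rw [← mul_le_mul_iff_right₀ hc]
    calc _ ≤ _ := hY
      _ ≤ _ := hen
      _ ≤ b * (c' * (Y ^ ((p - 1) / p) * (B * (Y ^ (1 / 2 : ℝ) * M ^ ((2 - p) / (2 * p)))))) := by
          refine mul_le_mul_of_nonneg_left (hDw.trans ?_) hb
          refine mul_le_mul_of_nonneg_left ?_ hc'
          refine mul_le_mul_of_nonneg_left (hpoin.trans ?_) (by positivity)
          rw [← hsplit]
          exact mul_le_mul_of_nonneg_left (Real.rpow_le_rpow nZ hZ (by positivity)) hB
      _ = c * (b' * M ^ ((2 - p) / (2 * p)) * (Y ^ ((p - 1) / p) * Y ^ (1 / 2 : ℝ))) := by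
          rw [hb']; field_simp
      _ = _ := by
          rw [← Real.rpow_add_of_nonneg nT (by positivity) (by positivity)]
          congr 3
          field_simp
          ring)
  calc _ ≤ _ := hZ
    _ ≤ (b' ^ (1 / ((2 - p) / (2 * p))) * M) ^ (p / 2) * M ^ (1 - p / 2) := by
        gcongr
    _ = b' ^ (p ^ 2 / (2 - p)) * (M ^ (p / 2) * M ^ (1 - p / 2)) := by
        rw [Real.mul_rpow (by positivity) nS, ← Real.rpow_mul hb'0, mul_assoc]
        congr 2
        field_simp
    _ = _ := by
        rw [← Real.rpow_add_of_nonneg nS (by positivity) (by linarith)]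
        simp

end Absorption

/-! ### Energy estimates for weak solutions -/

section Energy

variable {E : Type*} [NormedAddCommGroup E] [InnerProductSpace ℝ E] [MeasurableSpace E]
  [BorelSpace E]

lemma memLp_comp_of_growth {α : Type*} [MeasurableSpace α] {μ : Measure α} {p : ℝ} (hp : 1 < p)
    [FiniteDimensional ℝ E] {A : E → E} (hA : Measurable A) {K : ℝ}
    (hK : ∀ z, ‖A z‖ ≤ K * ‖z‖ ^ (p - 1)) {g : α → E} (hg : MemLp g (ENNReal.ofReal p) μ) :
    MemLp (fun x => A (g x)) (ENNReal.ofReal (p / (p - 1))) μ := by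
  have hp1 : 0 < p - 1 := by linarith
  have h := hg.norm_rpow_div (ENNReal.ofReal (p - 1))
  rw [ENNReal.toReal_ofReal hp1.le, ← ENNReal.ofReal_div_of_pos hp1] at h
  refine h.of_le_mul (c := K) (hA.comp_aemeasurable hg.1.aemeasurable).aestronglyMeasurable
    (.of_forall fun x => ?_)
  rw [Real.norm_of_nonneg (by positivity)]
  exact hK _

variable [FiniteDimensional ℝ E]

lemma MemW01p.integral_rpow_le {p : ℝ} (hp : 1 < p) {Ω : Set E} {u : E → ℝ} {g : E → E}
    (hu : MemW01p p Ω u g) {e : E} (he : ‖e‖ = 1) {R : ℝ} (hR : 0 ≤ R)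
    (hs : ∀ x ∈ Ω, |⟪x, e⟫| ≤ R) :
    (∫ x in Ω, ‖u x‖ ^ p) ^ (1 / p) ≤ p * R * (∫ x in Ω, ‖⟪g x, e⟫‖ ^ p) ^ (1 / p) := by
  have hp0 : 0 < p := by linarith
  have h := hu.eLpNorm_le hp he hR hs
  have hg : MemLp (fun x => ⟪g x, e⟫) (ENNReal.ofReal p) (volume.restrict Ω) :=
    hu.1.2.2.inner_const e
  rw [hu.1.2.1.eLpNorm_ofReal_eq hp0, hg.eLpNorm_ofReal_eq hp0,
    ← ENNReal.ofReal_mul (by positivity), ENNReal.ofReal_le_ofReal_iff (by positivity)] at h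
  exact h

/-- The energy bound obtained by testing the equation with its solution. -/
lemma MemW01p.energy_le {p : ℝ} (hp : 1 < p) {Ω : Set E} {u F : E → ℝ} {g : E → E}
    (hu : MemW01p p Ω u g) {e : E} (he : ‖e‖ = 1) {R : ℝ} (hR : 0 ≤ R)
    (hs : ∀ x ∈ Ω, |⟪x, e⟫| ≤ R) {A : E → E} {c : ℝ} (hc : 0 < c)
    (hA : ∀ z, c * ‖z‖ ^ p ≤ ⟪A z, z⟫)
    (hAg : MemLp (fun x => A (g x)) (ENNReal.ofReal (p / (p - 1))) (volume.restrict Ω))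
    (hF : MemLp F (ENNReal.ofReal (p / (p - 1))) (volume.restrict Ω))
    (heq : ∫ x in Ω, ⟪A (g x), g x⟫ = ∫ x in Ω, F x * u x) :
    ∫ x in Ω, ‖g x‖ ^ p ≤ (p * R / c) ^ (p / (p - 1)) * ∫ x in Ω, ‖F x‖ ^ (p / (p - 1)) := by
  have hp0 : 0 < p := by linarith
  have hp1 : 0 < p - 1 := by linarith
  have hq0 : 0 < p / (p - 1) := by positivity
  have hconj := (Real.HolderConjugate.conjExponent hp).symm.ennrealOfReal
  rw [Real.conjExponent] at hconj
  have hs0 : 0 < (p - 1) / p := by positivity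
  have hs1 : (p - 1) / p < 1 := by rw [div_lt_one hp0]; linarith
  have hs2 : 1 - (p - 1) / p = 1 / p := by field_simp; ring
  have ig := hu.1.2.2.integrable_norm_rpow_ofReal hp0
  have iAg : IntegrableOn (fun x => ⟪A (g x), g x⟫) Ω := by
    have hi : Integrable (fun x => ‖A (g x)‖ * ‖g x‖) (volume.restrict Ω) :=
      hAg.norm.integrable_mul hu.1.2.2.norm
    exact hi.mono' (hAg.1.inner hu.1.2.2.1) (.of_forall fun x => norm_inner_le_norm _ _)
  obtain ⟨iH, hH⟩ := integral_rpow_mul_rpow_le (μ := volume.restrict Ω)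
    (f := fun x => ‖F x‖ ^ (p / (p - 1))) (g := fun x => ‖u x‖ ^ p) (fun x => by positivity)
    (fun x => by positivity) (hF.integrable_norm_rpow_ofReal hq0)
    (hu.1.2.1.integrable_norm_rpow_ofReal hp0) hs0 hs1
  have e1 : ∀ x, (‖F x‖ ^ (p / (p - 1))) ^ ((p - 1) / p) * (‖u x‖ ^ p) ^ (1 - (p - 1) / p)
      = ‖F x * u x‖ := fun x => by
    rw [hs2, ← Real.rpow_mul (norm_nonneg _), ← Real.rpow_mul (norm_nonneg _),
      mul_one_div_cancel hp0.ne', div_mul_div_cancel₀ hp1.ne', div_self hp0.ne', Real.rpow_one,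
      Real.rpow_one, norm_mul]
  simp only [e1] at hH
  rw [hs2] at hH
  have h1 : c * ∫ x in Ω, ‖g x‖ ^ p ≤ ∫ x in Ω, ‖F x * u x‖ := by
    rw [← integral_const_mul]
    refine (integral_mono (ig.const_mul c) iAg fun x => hA (g x)).trans ?_
    rw [heq]
    exact (Real.le_norm_self _).trans (norm_integral_le_integral_norm _)
  have h2 : ∫ x in Ω, ‖⟪g x, e⟫‖ ^ p ≤ ∫ x in Ω, ‖g x‖ ^ p := by
    refine integral_mono_of_nonneg (.of_forall fun x => by positivity) ig (.of_forall fun x => ?_)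
    simp only
    gcongr
    simpa [he] using norm_inner_le_norm (𝕜 := ℝ) (g x) e
  have n1 : 0 ≤ ∫ x in Ω, ‖⟪g x, e⟫‖ ^ p := integral_nonneg fun x => by positivity
  have n2 : 0 ≤ ∫ x in Ω, ‖F x‖ ^ (p / (p - 1)) := integral_nonneg fun x => by positivity
  have n3 : 0 ≤ ∫ x in Ω, ‖g x‖ ^ p := integral_nonneg fun x => by positivity
  have key := le_rpow_mul_of_le_mul_rpow (b := p * R / c) n3 (by positivity) n2 hs0 (by
    rw [hs2, ← mul_le_mul_iff_right₀ hc]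
    calc _ ≤ _ := h1
      _ ≤ _ := hH
      _ ≤ (∫ x in Ω, ‖F x‖ ^ (p / (p - 1))) ^ ((p - 1) / p) *
            (p * R * (∫ x in Ω, ‖g x‖ ^ p) ^ (1 / p)) := by
          refine mul_le_mul_of_nonneg_left ((hu.integral_rpow_le hp he hR hs).trans ?_)
            (by positivity)
          gcongr
      _ = _ := by field_simp)
  rwa [one_div_div] at key

end Energy

/-! ### The difference of the two solutions on a cylinder -/

section Difference

variable {m k : ℕ} {p ℓ : ℝ} {H : ProdSpace m k → ℝ} {U : Set (EuclideanSpace ℝ (Fin m))}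
  {ω₂ : Set (EuclideanSpace ℝ (Fin k))} {f uInf : EuclideanSpace ℝ (Fin k) → ℝ}
  {g₀ : EuclideanSpace ℝ (Fin k) → EuclideanSpace ℝ (Fin k)} {u : ProdSpace m k → ℝ}
  {g : ProdSpace m k → ProdSpace m k} {η : EuclideanSpace ℝ (Fin m) → ℝ}

lemma inner_toLp_snd (x : ProdSpace m k) (e : EuclideanSpace ℝ (Fin k)) :
    ⟪x, (WithLp.toLp 2 (0, e) : ProdSpace m k)⟫ = ⟪x.snd, e⟫ :=
  (congrArg₂ (· + ·) (inner_zero_right x.fst) rfl).trans (zero_add _)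

/-- The difference of the two solutions, multiplied by a cut-off function of `X₁`, is admissible in
the equation on the cylinder. -/
lemma memW01p_cutoff_mul_sub (hp : 1 < p) (hU : MeasurableSet (ℓ • U))
    (hUf : volume (ℓ • U) ≠ ⊤) (h2 : MeasurableSet ω₂) (hInf : MemW01p p ω₂ uInf g₀)
    (hu : MemW01p p (finiteCylinder U ω₂ ℓ) u g) (hη : IsTestFunction (ℓ • U) η) :
    MemW01p p (finiteCylinder U ω₂ ℓ) (fun x => η x.fst * (u x - uInf x.snd))
      (fun x => η x.fst • (g x - WithLp.toLp 2 (0, g₀ x.snd)) +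
        (u x - uInf x.snd) • gradient (fun y : ProdSpace m k => η y.fst) x) := by
  obtain ⟨φ, hφ, ha⟩ := hu.exists_approx
  obtain ⟨ψ, hψ, hb⟩ := hInf.exists_approx
  obtain ⟨K, hK⟩ := hη.1.continuous.bounded_above_of_compact_support hη.2.1
  obtain ⟨L, hL⟩ := hη.continuous_gradient.bounded_above_of_compact_support hη.2.1.gradient
  have h := (ha.sub hp (hb.comp_snd hU hUf h2)).mul hp (η := fun x : ProdSpace m k => η x.fst)
    (hη.1.comp (fstCLM m k).contDiff) (K := K) (L := L) (fun x => hK _) fun x => by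
      rw [gradient_comp_fst (hη.1.differentiable (by simp)), WithLp.norm_toLp_fst]
      exact hL _
  exact h.memW01p hp fun j => hη.mul_sub_snd (hφ j) (hψ j)

lemma hasWeakGradient_sub (hp : 1 < p) (hU : MeasurableSet (ℓ • U))
    (hUf : volume (ℓ • U) ≠ ⊤) (h2 : MeasurableSet ω₂) (hInf : MemW01p p ω₂ uInf g₀)
    (hu : MemW01p p (finiteCylinder U ω₂ ℓ) u g) :
    HasWeakGradient (finiteCylinder U ω₂ ℓ) (fun x => u x - uInf x.snd)
      (fun x => g x - WithLp.toLp 2 (0, g₀ x.snd)) := by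
  obtain ⟨φ, hφ, ha⟩ := hu.exists_approx
  obtain ⟨ψ, hψ, hb⟩ := hInf.exists_approx
  exact (ha.sub hp (hb.comp_snd hU hUf h2)).hasWeakGradient hp

lemma memLp_gradient_extension (hU : MeasurableSet (ℓ • U)) (hUf : volume (ℓ • U) ≠ ⊤)
    (h2 : MeasurableSet ω₂) (hInf : MemW01p p ω₂ uInf g₀) :
    MemLp (fun x : ProdSpace m k => (WithLp.toLp 2 (0, g₀ x.snd) : ProdSpace m k))
      (ENNReal.ofReal p) (volume.restrict (finiteCylinder U ω₂ ℓ)) :=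
  memLp_comp_snd (h := fun y => inrCLM m k (g₀ y)) hU hUf h2 ENNReal.ofReal_ne_top
    ((inrCLM m k).comp_memLp' hInf.1.2.2)

/-- The Poincaré inequality in a direction `(0, e)` of the cross-section. The derivative of the
cut-off function in this direction vanishes, so that only the gradient of the difference
remains. -/
lemma poincare_cutoff_mul_sub (hp : 1 < p) (hU : MeasurableSet (ℓ • U))
    (hUf : volume (ℓ • U) ≠ ⊤) (h2 : MeasurableSet ω₂) (hInf : MemW01p p ω₂ uInf g₀)
    (hu : MemW01p p (finiteCylinder U ω₂ ℓ) u g) (hη : IsTestFunction (ℓ • U) η)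
    (h0 : ∀ x, η x ∈ Icc (0 : ℝ) 1) {e : EuclideanSpace ℝ (Fin k)} (he : ‖e‖ = 1) {R : ℝ}
    (hR : 0 ≤ R) (hs : ∀ y ∈ ω₂, ‖y‖ ≤ R) :
    (∫ x in finiteCylinder U ω₂ ℓ, (η x.fst * ‖u x - uInf x.snd‖) ^ p) ^ (1 / p) ≤
      p * R * (∫ x in finiteCylinder U ω₂ ℓ,
        (η x.fst * ‖g x - WithLp.toLp 2 (0, g₀ x.snd)‖) ^ p) ^ (1 / p) := by
  have hp0 : 0 < p := by linarith
  have he' : ‖(WithLp.toLp 2 (0, e) : ProdSpace m k)‖ = 1 := by rw [WithLp.norm_toLp_snd, he]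
  have hs' : ∀ x ∈ finiteCylinder U ω₂ ℓ, |⟪x, (WithLp.toLp 2 (0, e) : ProdSpace m k)⟫| ≤ R := by
    intro x hx
    rw [inner_toLp_snd]
    refine (abs_real_inner_le_norm _ _).trans ?_
    rw [he, mul_one]
    exact hs _ hx.2
  have h := (memW01p_cutoff_mul_sub hp hU hUf h2 hInf hu hη).integral_rpow_le hp he' hR hs'
  have e1 : ∀ x : ProdSpace m k, ‖η x.fst * (u x - uInf x.snd)‖ =
      η x.fst * ‖u x - uInf x.snd‖ := fun x => by
    rw [norm_mul, Real.norm_of_nonneg (h0 _).1]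
  simp only [e1] at h
  have iG : Integrable (fun x : ProdSpace m k =>
      (η x.fst * ‖g x - WithLp.toLp 2 (0, g₀ x.snd)‖) ^ p)
      (volume.restrict (finiteCylinder U ω₂ ℓ)) :=
    integrable_rpow_mul_of_le_one hp0 (hu.1.2.2.sub (memLp_gradient_extension hU hUf h2 hInf))
      (hη.1.continuous.comp continuous_prodSpace_fst).aestronglyMeasurable
      (fun x => (h0 _).1) fun x => (h0 _).2
  refine h.trans (mul_le_mul_of_nonneg_left ?_ (by positivity))
  refine Real.rpow_le_rpow (integral_nonneg fun x => by positivity) ?_ (by positivity)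
  refine integral_mono_of_nonneg (.of_forall fun x => by positivity) iG (.of_forall fun x => ?_)
  simp only
  refine Real.rpow_le_rpow (norm_nonneg _) ?_ hp0.le
  rw [inner_add_left, real_inner_smul_left, real_inner_smul_left,
    gradient_comp_fst (hη.1.differentiable (by simp))]
  have e2 : ⟪(WithLp.toLp 2 (gradient η x.fst, 0) : ProdSpace m k), WithLp.toLp 2 (0, e)⟫ = 0 := by
    rw [inner_toLp_snd]
    exact inner_zero_left _
  rw [e2, mul_zero, add_zero, norm_mul, Real.norm_of_nonneg (h0 _).1]
  refine mul_le_mul_of_nonneg_left ?_ (h0 _).1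
  exact (norm_inner_le_norm _ _).trans_eq (by rw [he', mul_one])

/-- Both solutions satisfy the equation for test functions in `W₀^{1,p}` of the cylinder; the
difference of the two equations is tested with `η ^ n (u - u_∞)`. -/
lemma integral_flux_sub_le (hp : 1 < p) (hH : IsAnisotropy H) (hU : MeasurableSet (ℓ • U))
    (hUf : volume (ℓ • U) ≠ ⊤) (h2 : MeasurableSet ω₂)
    (hf : MemLp f (ENNReal.ofReal (p / (p - 1))) (volume.restrict ω₂))
    (hInf : MemW01p p ω₂ uInf g₀)
    (eInf : ∀ φ γ, MemW01p p ω₂ φ γ →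
      ∫ y in ω₂, ⟪crossFlux p H (g₀ y), γ y⟫ = ∫ y in ω₂, f y * φ y)
    (hu : MemW01p p (finiteCylinder U ω₂ ℓ) u g)
    (eu : ∀ φ γ, MemW01p p (finiteCylinder U ω₂ ℓ) φ γ →
      ∫ x in finiteCylinder U ω₂ ℓ, ⟪finslerFlux p H (g x), γ x⟫ =
        ∫ x in finiteCylinder U ω₂ ℓ, f x.snd * φ x)
    (hη : IsTestFunction (ℓ • U) η) (h0 : ∀ x, η x ∈ Icc (0 : ℝ) 1) {L : ℝ}
    (hL : ∀ x, ‖gradient η x‖ ≤ L) {n : ℕ} (hn : n ≠ 0) :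
    ∫ x in finiteCylinder U ω₂ ℓ, η x.fst ^ n *
        ⟪finslerFlux p H (g x) - finslerFlux p H (WithLp.toLp 2 (0, g₀ x.snd)),
          g x - WithLp.toLp 2 (0, g₀ x.snd)⟫ ≤
      n * L * ∫ x in finiteCylinder U ω₂ ℓ,
        ‖finslerFlux p H (g x) - finslerFlux p H (WithLp.toLp 2 (0, g₀ x.snd))‖ *
          (η x.fst ^ (n - 1) * ‖u x - uInf x.snd‖) := by
  have hp0 : 0 < p := by linarith
  have hp1 : 0 < p - 1 := by linarith
  have hq1 : 1 < p / (p - 1) := by rw [lt_div_iff₀ hp1]; linarith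
  obtain ⟨K, hK0, hK⟩ := hH.exists_norm_flux_le hp
  have hconj := (Real.HolderConjugate.conjExponent hp).symm.ennrealOfReal
  rw [Real.conjExponent] at hconj
  have hA := hH.measurable_flux p
  set Ω := finiteCylinder U ω₂ ℓ with hΩ
  have mG₀ := memLp_gradient_extension (m := m) hU hUf h2 hInf
  have mV : MemLp (fun y => finslerFlux p H (WithLp.toLp 2 (0, g₀ y)))
      (ENNReal.ofReal (p / (p - 1))) (volume.restrict ω₂) :=
    memLp_comp_of_growth hp hA hK ((inrCLM m k).comp_memLp' hInf.1.2.2)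
  have mV' : MemLp (fun x : ProdSpace m k => finslerFlux p H (WithLp.toLp 2 (0, g₀ x.snd)))
      (ENNReal.ofReal (p / (p - 1))) (volume.restrict Ω) :=
    memLp_comp_of_growth hp hA hK mG₀
  have mA := memLp_comp_of_growth hp hA hK hu.1.2.2
  have mD := mA.sub mV'
  have mf : MemLp (fun x : ProdSpace m k => f x.snd) (ENNReal.ofReal (p / (p - 1)))
      (volume.restrict Ω) := memLp_comp_snd hU hUf h2 ENNReal.ofReal_ne_top hf
  have mη : AEStronglyMeasurable (fun x : ProdSpace m k => η x.fst) (volume.restrict Ω) :=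
    (hη.1.continuous.comp continuous_prodSpace_fst).aestronglyMeasurable
  have mG := hu.1.2.2.sub mG₀
  have mw : MemLp (fun x => u x - uInf x.snd) (ENNReal.ofReal p) (volume.restrict Ω) :=
    hu.1.2.1.sub (memLp_comp_snd hU hUf h2 ENNReal.ofReal_ne_top hInf.1.2.1)
  have hv := memW01p_cutoff_mul_sub hp hU hUf h2 hInf hu (hη.pow hn)
  have q1 := eu _ _ hv
  have q2 := hv.integral_eq_of_isTestFunction hp mV' mf fun φ hφ =>
    hφ.integral_cylinder_eq hU hUf h2 hq1 mV hf fun χ hχ => eInf _ _ (hχ.memW01p hp)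
  have i1 : Integrable (fun x => ⟪finslerFlux p H (g x), η x.fst ^ n • (g x - WithLp.toLp 2
      (0, g₀ x.snd)) + (u x - uInf x.snd) • gradient (fun y : ProdSpace m k => η y.fst ^ n) x⟫)
      (volume.restrict Ω) := by
    have hi := mA.norm.integrable_mul hv.1.2.2.norm
    exact hi.mono' (mA.1.inner hv.1.2.2.1) (.of_forall fun x => norm_inner_le_norm _ _)
  have i2 : Integrable (fun x : ProdSpace m k => ⟪finslerFlux p H (WithLp.toLp 2 (0, g₀ x.snd)),
      η x.fst ^ n • (g x - WithLp.toLp 2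
      (0, g₀ x.snd)) + (u x - uInf x.snd) • gradient (fun y : ProdSpace m k => η y.fst ^ n) x⟫)
      (volume.restrict Ω) := by
    have hi := mV'.norm.integrable_mul hv.1.2.2.norm
    exact hi.mono' (mV'.1.inner hv.1.2.2.1) (.of_forall fun x => norm_inner_le_norm _ _)
  have hz := (integral_sub i1 i2).trans (sub_eq_zero.2 (q1.trans q2.symm))
  simp only [← inner_sub_left] at hz
  set D : ProdSpace m k → ProdSpace m k :=
    fun x => finslerFlux p H (g x) - finslerFlux p H (WithLp.toLp 2 (0, g₀ x.snd)) with hD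
  set G : ProdSpace m k → ProdSpace m k := fun x => g x - WithLp.toLp 2 (0, g₀ x.snd) with hG
  set w : ProdSpace m k → ℝ := fun x => u x - uInf x.snd with hw
  have i3 : Integrable (fun x => η x.fst ^ n * ⟪D x, G x⟫) (volume.restrict Ω) := by
    have hi : Integrable (fun x => ‖D x‖ * ‖G x‖) (volume.restrict Ω) :=
      mD.norm.integrable_mul mG.norm
    refine hi.mono' ((mη.pow n).mul (mD.1.inner mG.1)) (.of_forall fun x => ?_)
    rw [norm_mul, Real.norm_of_nonneg (pow_nonneg (h0 _).1 _)]
    exact (mul_le_of_le_one_left (norm_nonneg _) (pow_le_one₀ (h0 _).1 (h0 _).2)).trans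
      (norm_inner_le_norm _ _)
  have i4 : Integrable (fun x => ‖D x‖ * (η x.fst ^ (n - 1) * ‖w x‖)) (volume.restrict Ω) := by
    have hi : Integrable (fun x => ‖D x‖ * ‖w x‖) (volume.restrict Ω) :=
      mD.norm.integrable_mul mw.norm
    refine hi.mono' (mD.1.norm.mul ((mη.pow (n - 1)).mul mw.1.norm)) (.of_forall fun x => ?_)
    have := pow_nonneg (h0 x.fst).1 (n - 1)
    rw [Real.norm_of_nonneg (by positivity)]
    exact mul_le_mul_of_nonneg_left (mul_le_of_le_one_left (norm_nonneg _)
      (pow_le_one₀ (h0 _).1 (h0 _).2)) (norm_nonneg _)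
  have hsplit : ∀ x, ⟪D x, η x.fst ^ n • G x + w x •
      gradient (fun y : ProdSpace m k => η y.fst ^ n) x⟫ = η x.fst ^ n * ⟪D x, G x⟫ +
      w x * ⟪D x, gradient (fun y : ProdSpace m k => η y.fst ^ n) x⟫ := fun x => by
    rw [inner_add_right, real_inner_smul_right, real_inner_smul_right]
  have i5 : Integrable (fun x => ⟪D x, η x.fst ^ n • G x + w x •
      gradient (fun y : ProdSpace m k => η y.fst ^ n) x⟫) (volume.restrict Ω) := by
    refine (i1.sub i2).congr (.of_forall fun x => ?_)
    simp only [Pi.sub_apply, ← inner_sub_left]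
    rfl
  have hid : ∫ x in Ω, η x.fst ^ n * ⟪D x, G x⟫ =
      ∫ x in Ω, -(w x * ⟪D x, gradient (fun y : ProdSpace m k => η y.fst ^ n) x⟫) := by
    rw [← sub_eq_zero, ← hz, ← sub_eq_zero]
    have e : ∀ x, -(w x * ⟪D x, gradient (fun y : ProdSpace m k => η y.fst ^ n) x⟫) =
        η x.fst ^ n * ⟪D x, G x⟫ - ⟪D x, η x.fst ^ n • G x + w x •
      gradient (fun y : ProdSpace m k => η y.fst ^ n) x⟫ := fun x => by
      rw [hsplit]; ring
    simp only [e]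
    rw [integral_sub i3 i5]
    ring
  rw [hid, ← integral_const_mul]
  refine (Real.le_norm_self _).trans ((norm_integral_le_integral_norm _).trans ?_)
  refine integral_mono_of_nonneg (.of_forall fun x => norm_nonneg _) (i4.const_mul _)
    (.of_forall fun x => ?_)
  simp only
  have hgr : ‖gradient (fun y : ProdSpace m k => η y.fst ^ n) x‖ ≤ n * η x.fst ^ (n - 1) * L := by
    rw [gradient_comp_fst (η := fun z => η z ^ n) ((hη.pow hn).1.differentiable (by simp)),
      WithLp.norm_toLp_fst, gradient_pow (hη.1.differentiable (by simp) _), norm_smul,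
      Real.norm_of_nonneg (mul_nonneg n.cast_nonneg (pow_nonneg (h0 _).1 _))]
    exact mul_le_mul_of_nonneg_left (hL _) (mul_nonneg n.cast_nonneg (pow_nonneg (h0 _).1 _))
  rw [norm_neg, norm_mul]
  calc ‖w x‖ * ‖⟪D x, gradient (fun y : ProdSpace m k => η y.fst ^ n) x⟫‖
      ≤ ‖w x‖ * (‖D x‖ * (n * η x.fst ^ (n - 1) * L)) := by
        gcongr
        exact (norm_inner_le_norm _ _).trans (mul_le_mul_of_nonneg_left hgr (norm_nonneg _))
    _ = _ := by ring

/-- The energies of both solutions on the cylinder are bounded by the length to the power `m`. -/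
lemma exists_integral_add_rpow_le (hp : 1 < p) (hk : 1 ≤ k) (hH : IsAnisotropy H)
    (hU : IsOpen U) (hUb : Bornology.IsBounded U) (h2 : IsOpen ω₂)
    (h2b : Bornology.IsBounded ω₂)
    (hf : MemLp f (ENNReal.ofReal (p / (p - 1))) (volume.restrict ω₂))
    (hInf : MemW01p p ω₂ uInf g₀) {c : ℝ} (hc : 0 < c)
    (hco : ∀ z, c * ‖z‖ ^ p ≤ ⟪finslerFlux p H z, z⟫) :
    ∃ C : ℝ, 0 ≤ C ∧ ∀ ℓ : ℝ, 0 < ℓ → ∀ (u : ProdSpace m k → ℝ)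
      (g : ProdSpace m k → ProdSpace m k), MemW01p p (finiteCylinder U ω₂ ℓ) u g →
      (∀ φ γ, MemW01p p (finiteCylinder U ω₂ ℓ) φ γ →
        ∫ x in finiteCylinder U ω₂ ℓ, ⟪finslerFlux p H (g x), γ x⟫ =
          ∫ x in finiteCylinder U ω₂ ℓ, f x.snd * φ x) →
      ∫ x in finiteCylinder U ω₂ ℓ, (‖g x‖ + ‖(WithLp.toLp 2 (0, g₀ x.snd) : ProdSpace m k)‖) ^ p ≤
        C * ℓ ^ m := by
  have hp0 : 0 < p := by linarith
  have hp1 : 0 < p - 1 := by linarith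
  have hq0 : 0 < p / (p - 1) := by positivity
  obtain ⟨R, hR0, hR⟩ := h2b.exists_pos_norm_le
  obtain ⟨K, hK0, hK⟩ := hH.exists_norm_flux_le hp
  have hA := hH.measurable_flux p
  have hUv : volume U ≠ ⊤ := hUb.measure_lt_top.ne
  set e : EuclideanSpace ℝ (Fin k) := EuclideanSpace.single ⟨0, hk⟩ 1
  have he : ‖e‖ = 1 := by simp [e]
  have he' : ‖(WithLp.toLp 2 (0, e) : ProdSpace m k)‖ = 1 := by rw [WithLp.norm_toLp_snd, he]
  obtain ⟨I, hI⟩ : ∃ I, I = ∫ y in ω₂, ‖f y‖ ^ (p / (p - 1)) := ⟨_, rfl⟩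
  obtain ⟨J, hJ⟩ : ∃ J, J = ∫ y in ω₂, ‖g₀ y‖ ^ p := ⟨_, rfl⟩
  have hI0 : 0 ≤ I := hI ▸ integral_nonneg fun x => Real.rpow_nonneg (norm_nonneg _) _
  have hJ0 : 0 ≤ J := hJ ▸ integral_nonneg fun x => Real.rpow_nonneg (norm_nonneg _) _
  refine ⟨2 ^ (p - 1) * ((p * R / c) ^ (p / (p - 1)) * ((volume U).toReal * I) +
    (volume U).toReal * J), by positivity, fun ℓ hℓ u g hu eu => ?_⟩
  have hUm : MeasurableSet (ℓ • U) := (hU.smul₀ hℓ.ne').measurableSet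
  have hvol : (volume (ℓ • U)).toReal = ℓ ^ m * (volume U).toReal := by
    rw [volume_smul_set hℓ.le, ENNReal.toReal_mul, ENNReal.toReal_ofReal (by positivity)]
  have hUf : volume (ℓ • U) ≠ ⊤ := by
    rw [volume_smul_set hℓ.le]
    exact ENNReal.mul_ne_top ENNReal.ofReal_ne_top hUv
  have hs' : ∀ x ∈ finiteCylinder U ω₂ ℓ, |⟪x, (WithLp.toLp 2 (0, e) : ProdSpace m k)⟫| ≤ R := by
    intro x hx
    rw [inner_toLp_snd]
    refine (abs_real_inner_le_norm _ _).trans ?_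
    rw [he, mul_one]
    exact hR _ hx.2
  have mG₀ := memLp_gradient_extension (m := m) hUm hUf h2.measurableSet hInf
  have mf : MemLp (fun x : ProdSpace m k => f x.snd) (ENNReal.ofReal (p / (p - 1)))
      (volume.restrict (finiteCylinder U ω₂ ℓ)) :=
    memLp_comp_snd hUm hUf h2.measurableSet ENNReal.ofReal_ne_top hf
  have b1 := hu.energy_le hp he' hR0.le hs' hc hco (memLp_comp_of_growth hp hA hK hu.1.2.2) mf
    (eu _ _ hu)
  have b2 : ∫ x in finiteCylinder U ω₂ ℓ, ‖f x.snd‖ ^ (p / (p - 1)) =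
      ℓ ^ m * (volume U).toReal * I := by
    rw [setIntegral_comp_snd (h := fun y => ‖f y‖ ^ (p / (p - 1))) hUm h2.measurableSet
      (hf.integrable_norm_rpow_ofReal hq0).1, hvol, smul_eq_mul, hI]
  have b3 : ∫ x in finiteCylinder U ω₂ ℓ, ‖(WithLp.toLp 2 (0, g₀ x.snd) : ProdSpace m k)‖ ^ p =
      ℓ ^ m * (volume U).toReal * J := by
    simp only [WithLp.norm_toLp_snd]
    rw [setIntegral_comp_snd (h := fun y => ‖g₀ y‖ ^ p) hUm h2.measurableSet
      (hInf.1.2.2.integrable_norm_rpow_ofReal hp0).1, hvol, smul_eq_mul, hJ]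
  have i1 := hu.1.2.2.integrable_norm_rpow_ofReal hp0
  have i2 := mG₀.integrable_norm_rpow_ofReal hp0
  calc _ ≤ ∫ x in finiteCylinder U ω₂ ℓ, 2 ^ (p - 1) * (‖g x‖ ^ p +
          ‖(WithLp.toLp 2 (0, g₀ x.snd) : ProdSpace m k)‖ ^ p) :=
        integral_mono_of_nonneg (.of_forall fun x => by positivity) ((i1.add i2).const_mul _)
          (.of_forall fun x => by
            exact_mod_cast NNReal.rpow_add_le_mul_rpow_add_rpow ‖g x‖₊
              ‖(WithLp.toLp 2 (0, g₀ x.snd) : ProdSpace m k)‖₊ hp.le)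
    _ = 2 ^ (p - 1) * ((∫ x in finiteCylinder U ω₂ ℓ, ‖g x‖ ^ p) +
          ℓ ^ m * (volume U).toReal * J) := by
        rw [integral_const_mul, integral_add i1 i2, b3]
    _ ≤ 2 ^ (p - 1) * ((p * R / c) ^ (p / (p - 1)) * (ℓ ^ m * (volume U).toReal * I) +
          ℓ ^ m * (volume U).toReal * J) := by
        rw [← b2]
        gcongr
    _ = _ := by ring

/-- Passage from a bound for a weighted integral on the cylinder to the norm on the half
cylinder. -/
lemma eLpNorm_rpow_le_of_weighted (hp : 1 < p) (hU : IsOpen U) (hUc : Convex ℝ U)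
    (hU0 : 0 ∈ U) (h2 : IsOpen ω₂) (hℓ : 0 < ℓ) {G : ProdSpace m k → ProdSpace m k}
    (hG : MemLp G (ENNReal.ofReal p) (volume.restrict (finiteCylinder U ω₂ ℓ)))
    {F : ProdSpace m k → ℝ} (hF : IntegrableOn F (finiteCylinder U ω₂ ℓ)) (hF0 : ∀ x, 0 ≤ F x)
    (hFG : ∀ x, x.fst ∈ (ℓ / 2) • U → F x = ‖G x‖ ^ p) {B : ℝ}
    (hB : ∫ x in finiteCylinder U ω₂ ℓ, F x ≤ B) :
    eLpNorm G (ENNReal.ofReal p) (volume.restrict (finiteCylinder U ω₂ (ℓ / 2))) ^ p ≤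
      ENNReal.ofReal B := by
  have hp0 : 0 < p := by linarith
  have hsub : finiteCylinder U ω₂ (ℓ / 2) ⊆ finiteCylinder U ω₂ ℓ := fun x hx => by
    refine ⟨?_, hx.2⟩
    obtain ⟨y, hy, hxy⟩ := hx.1
    refine ⟨(1 / 2 : ℝ) • y, hUc.smul_mem_of_zero_mem hU0 hy (by norm_num), ?_⟩
    simp only at hxy ⊢
    rw [← hxy, smul_smul]
    congr 1
    ring
  have hG' := hG.mono_measure (Measure.restrict_mono_set volume hsub)
  have hm : MeasurableSet (finiteCylinder U ω₂ (ℓ / 2)) :=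
    (isOpen_finiteCylinder hU h2 (by positivity)).measurableSet
  have n1 : 0 ≤ ∫ x in finiteCylinder U ω₂ (ℓ / 2), ‖G x‖ ^ p :=
    integral_nonneg fun x => by positivity
  rw [hG'.eLpNorm_ofReal_eq hp0, ENNReal.ofReal_rpow_of_nonneg (by positivity) hp0.le,
    ← Real.rpow_mul n1, one_div_mul_cancel hp0.ne', Real.rpow_one]
  refine ENNReal.ofReal_le_ofReal (le_trans ?_ hB)
  rw [setIntegral_congr_fun hm fun x hx => (hFG x hx.1).symm]
  exact setIntegral_mono_set hF (.of_forall hF0) hsub.eventuallyLE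

end Difference

/-! ### The convergence rates -/

theorem theorem1p1 (m k : ℕ) (hm : 1 ≤ m) (hk : 1 ≤ k) (p : ℝ) (hp : 1 < p)
    (H : ProdSpace m k → ℝ) (hH : IsAnisotropy H)
    (ω₁ : Set (EuclideanSpace ℝ (Fin m))) (hω₁ : IsOpen ω₁) (hω₁b : Bornology.IsBounded ω₁)
    (hω₁c : Convex ℝ ω₁) (hω₁0 : (0 : EuclideanSpace ℝ (Fin m)) ∈ ω₁)
    (ω₂ : Set (EuclideanSpace ℝ (Fin k))) (hω₂ : IsOpen ω₂) (hω₂b : Bornology.IsBounded ω₂)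
    (f : EuclideanSpace ℝ (Fin k) → ℝ)
    (hf : MemLp f (ENNReal.ofReal (p / (p - 1))) (volume.restrict ω₂))
    (uInf : EuclideanSpace ℝ (Fin k) → ℝ)
    (huInf : IsWeakSolution p (crossFlux p H) ω₂ f uInf) :
    (2 ≤ p → MonotoneFluxGe p H →
      ∃ C : ℝ, 0 < C ∧ ∀ ℓ : ℝ, 0 < ℓ → ∀ u : ProdSpace m k → ℝ,
        IsWeakSolution p (finslerFlux p H) (finiteCylinder ω₁ ω₂ ℓ) (fun x => f x.snd) u →
        ∃ w : ProdSpace m k → ProdSpace m k,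
          HasWeakGradient (finiteCylinder ω₁ ω₂ ℓ) (fun x => u x - uInf x.snd) w ∧
          eLpNorm w (ENNReal.ofReal p) (volume.restrict (finiteCylinder ω₁ ω₂ (ℓ / 2))) ^ p ≤
            ENNReal.ofReal (C * ℓ ^ ((m : ℝ) - p / (p - 1)))) ∧
    (p < 2 → MonotoneFluxLt p H → LipschitzFlux p H →
      ∃ C : ℝ, 0 < C ∧ ∀ ℓ : ℝ, 0 < ℓ → ∀ u : ProdSpace m k → ℝ,
        IsWeakSolution p (finslerFlux p H) (finiteCylinder ω₁ ω₂ ℓ) (fun x => f x.snd) u →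
        ∃ w : ProdSpace m k → ProdSpace m k,
          HasWeakGradient (finiteCylinder ω₁ ω₂ ℓ) (fun x => u x - uInf x.snd) w ∧
          eLpNorm w (ENNReal.ofReal p) (volume.restrict (finiteCylinder ω₁ ω₂ (ℓ / 2))) ^ p ≤
            ENNReal.ofReal (C * ℓ ^ ((m : ℝ) - p ^ 2 / (2 - p)))) := by

  obtain ⟨g₀, hInf, eInf⟩ := huInf
  have hp0 : 0 < p := by linarith
  have hp1 : 0 < p - 1 := by linarith
  have hq0 : 0 < p / (p - 1) := by positivity
  obtain ⟨R, hR0, hR⟩ := hω₂b.exists_pos_norm_le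
  obtain ⟨L, hL0, hcut⟩ := exists_scaled_cutoff hω₁ hω₁b hω₁c hω₁0
  obtain ⟨K, hK0, hK⟩ := hH.exists_norm_flux_le hp
  have hUm : ∀ ℓ : ℝ, 0 < ℓ → MeasurableSet (ℓ • ω₁) := fun ℓ hℓ =>
    (hω₁.smul₀ hℓ.ne').measurableSet
  have hUf : ∀ ℓ : ℝ, volume (ℓ • ω₁) ≠ ⊤ := fun ℓ => (hω₁b.smul₀ ℓ).measure_lt_top.ne
  have h2 := hω₂.measurableSet
  have he : ‖EuclideanSpace.single (⟨0, hk⟩ : Fin k) (1 : ℝ)‖ = 1 := by simp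
  have mη : ∀ {ℓ : ℝ} {η : EuclideanSpace ℝ (Fin m) → ℝ}, IsTestFunction (ℓ • ω₁) η →
      AEStronglyMeasurable (fun x : ProdSpace m k => η x.fst)
        (volume.restrict (finiteCylinder ω₁ ω₂ ℓ)) := fun hη =>
    (hη.1.continuous.comp continuous_prodSpace_fst).aestronglyMeasurable
  have mD : ∀ {ℓ : ℝ}, 0 < ℓ → ∀ {u : ProdSpace m k → ℝ} {g : ProdSpace m k → ProdSpace m k},
      MemW01p p (finiteCylinder ω₁ ω₂ ℓ) u g →
      MemLp (fun x => finslerFlux p H (g x) - finslerFlux p H (WithLp.toLp 2 (0, g₀ x.snd)))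
        (ENNReal.ofReal (p / (p - 1))) (volume.restrict (finiteCylinder ω₁ ω₂ ℓ)) :=
    fun hℓ _ _ hu => (memLp_comp_of_growth hp (hH.measurable_flux p) hK hu.1.2.2).sub
      (memLp_comp_of_growth hp (hH.measurable_flux p) hK
        (memLp_gradient_extension (hUm _ hℓ) (hUf _) h2 hInf))
  have mL : ∀ {ℓ : ℝ}, 0 < ℓ → ∀ {u : ProdSpace m k → ℝ} {g : ProdSpace m k → ProdSpace m k},
      MemW01p p (finiteCylinder ω₁ ω₂ ℓ) u g →
      MemLp (fun x => g x - WithLp.toLp 2 (0, g₀ x.snd)) (ENNReal.ofReal p)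
        (volume.restrict (finiteCylinder ω₁ ω₂ ℓ)) ∧
      MemLp (fun x => u x - uInf x.snd) (ENNReal.ofReal p)
        (volume.restrict (finiteCylinder ω₁ ω₂ ℓ)) ∧
      MemLp (fun x => ‖g x‖ + ‖(WithLp.toLp 2 (0, g₀ x.snd) : ProdSpace m k)‖)
        (ENNReal.ofReal p) (volume.restrict (finiteCylinder ω₁ ω₂ ℓ)) :=
    fun hℓ _ _ hu => ⟨hu.1.2.2.sub (memLp_gradient_extension (hUm _ hℓ) (hUf _) h2 hInf),
      hu.1.2.1.sub (memLp_comp_snd (hUm _ hℓ) (hUf _) h2 ENNReal.ofReal_ne_top hInf.1.2.1),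
      hu.1.2.2.norm.add (memLp_gradient_extension (hUm _ hℓ) (hUf _) h2 hInf).norm⟩
  constructor
  · rintro hp2 ⟨c, hc, hmon⟩
    -- Monotonicity against `z₂ = 0` is coercivity.
    have hco : ∀ z, c * ‖z‖ ^ p ≤ ⟪finslerFlux p H z, z⟫ := fun z => by
      simpa [hH.flux_zero hp] using hmon z 0
    obtain ⟨C, hC0, hC⟩ := exists_integral_add_rpow_le hp hk hH hω₁ hω₁b hω₂ hω₂b hf hInf hc hco
    -- The summand `1` makes the constant positive.
    refine ⟨(2 * L * (p * R) / c) ^ (p / (p - 1)) * ((2 * K) ^ (p / (p - 1)) * C) + 1,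
      by positivity, fun ℓ hℓ u ⟨g, hu, eu⟩ => ⟨fun x => g x - WithLp.toLp 2 (0, g₀ x.snd),
        hasWeakGradient_sub hp (hUm _ hℓ) (hUf _) h2 hInf hu, ?_⟩⟩
    obtain ⟨η, hη, h0, h1, hgr⟩ := hcut ℓ hℓ
    obtain ⟨mG, mw, mS⟩ := mL hℓ hu
    have hen := integral_flux_sub_le hp hH (hUm _ hℓ) (hUf _) h2 hf hInf eInf hu eu hη h0 hgr
      (n := 2) two_ne_zero
    simp only [Nat.add_one_sub_one, pow_one, Nat.cast_ofNat] at hen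
    have key := integral_sq_mul_le_of_two_le hp2 (mD hℓ hu) mG mw (mη hη) (fun x => (h0 _).1)
      (fun x => (h0 _).2) (b := 2 * (L / ℓ)) (B := p * R) (by positivity) (by positivity) hc
      (fun x => hmon _ _) hen
      (poincare_cutoff_mul_sub hp (hUm _ hℓ) (hUf _) h2 hInf hu hη h0 he hR0.le hR)
    -- The growth of the flux bounds `‖D‖ ^ (p / (p - 1))` by the energy density of both solutions.
    have hDS : ∫ x in finiteCylinder ω₁ ω₂ ℓ, ‖finslerFlux p H (g x) -
        finslerFlux p H (WithLp.toLp 2 (0, g₀ x.snd))‖ ^ (p / (p - 1)) ≤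
        (2 * K) ^ (p / (p - 1)) * (C * ℓ ^ m) := by
      refine le_trans ?_ (mul_le_mul_of_nonneg_left (hC ℓ hℓ u g hu eu) (by positivity))
      rw [← integral_const_mul]
      have iS := mS.integrable_norm_rpow_ofReal hp0
      refine integral_mono_of_nonneg (.of_forall fun x => by positivity)
        ((iS.congr (.of_forall fun x => ?_)).const_mul _) (.of_forall fun x => ?_)
      · simp only
        rw [Real.norm_of_nonneg (by positivity)]
      · simp only
        set a := ‖g x‖ with ha
        set b := ‖(WithLp.toLp 2 (0, g₀ x.snd) : ProdSpace m k)‖ with hb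
        have ha0 : 0 ≤ a := norm_nonneg _
        have hb0 : 0 ≤ b := norm_nonneg _
        have hle : ‖finslerFlux p H (g x) - finslerFlux p H (WithLp.toLp 2 (0, g₀ x.snd))‖ ≤
            2 * K * (a + b) ^ (p - 1) := by
          have l1 : a ^ (p - 1) ≤ (a + b) ^ (p - 1) :=
            Real.rpow_le_rpow ha0 (by linarith) hp1.le
          have l2 : b ^ (p - 1) ≤ (a + b) ^ (p - 1) :=
            Real.rpow_le_rpow hb0 (by linarith) hp1.le
          have l3 := mul_le_mul_of_nonneg_left l1 hK0
          have l4 := mul_le_mul_of_nonneg_left l2 hK0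
          linarith [norm_sub_le (finslerFlux p H (g x))
            (finslerFlux p H (WithLp.toLp 2 (0, g₀ x.snd))), hK (g x),
            hK (WithLp.toLp 2 (0, g₀ x.snd))]
        refine (Real.rpow_le_rpow (norm_nonneg _) hle hq0.le).trans_eq ?_
        rw [Real.mul_rpow (by positivity) (by positivity), ← Real.rpow_mul (by positivity),
          mul_div_cancel₀ _ hp1.ne']
    refine eLpNorm_rpow_le_of_weighted hp hω₁ hω₁c hω₁0 hω₂ hℓ mG
      (F := fun x => η x.fst ^ 2 * ‖g x - WithLp.toLp 2 (0, g₀ x.snd)‖ ^ p) ?_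
      (fun x => by positivity) (fun x hx => by rw [h1 _ hx]; simp) ?_
    · have iG := mG.integrable_norm_rpow_ofReal hp0
      refine iG.mono' (((mη hη).pow 2).mul iG.1) (.of_forall fun x => ?_)
      rw [Real.norm_of_nonneg (by positivity)]
      exact mul_le_of_le_one_left (by positivity) (pow_le_one₀ (h0 _).1 (h0 _).2)
    · refine key.trans ((mul_le_mul_of_nonneg_left hDS (by positivity)).trans ?_)
      have e1 : 2 * (L / ℓ) * (p * R) / c = (2 * L * (p * R) / c) * ℓ⁻¹ := by field_simp
      have e2 : ℓ ^ ((m : ℝ) - p / (p - 1)) = ℓ⁻¹ ^ (p / (p - 1)) * ℓ ^ m := by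
        rw [Real.rpow_sub hℓ, Real.inv_rpow hℓ.le, Real.rpow_natCast]
        field_simp
      rw [e1, e2, Real.mul_rpow (by positivity) (by positivity)]
      have : 0 ≤ ℓ⁻¹ ^ (p / (p - 1)) * ℓ ^ m := by positivity
      linarith
  · rintro hp2 ⟨c, hc, hmon⟩ ⟨c', hc', hlip⟩
    have hp3 : 0 < 2 - p := by linarith
    have hco : ∀ z, c * ‖z‖ ^ p ≤ ⟪finslerFlux p H z, z⟫ := fun z => by
      have h := hmon z 0
      simp only [hH.flux_zero hp, sub_zero, norm_zero, add_zero] at h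
      rcases eq_or_ne z 0 with rfl | hz
      · simp [Real.zero_rpow hp0.ne']
      · rwa [mul_assoc, ← Real.rpow_natCast ‖z‖ 2, ← Real.rpow_add (norm_pos_iff.2 hz),
          show ((2 : ℕ) : ℝ) + (p - 2) = p by push_cast; ring] at h
    obtain ⟨C, hC0, hC⟩ := exists_integral_add_rpow_le hp hk hH hω₁ hω₁b hω₂ hω₂b hf hInf hc hco
    obtain ⟨a, ha⟩ := exists_nat_ge (p / (2 - p))
    have ha0 : a ≠ 0 := by
      rintro rfl
      have : 0 < p / (2 - p) := by positivity
      simp only [Nat.cast_zero] at ha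
      linarith
    refine ⟨(2 * a * L * c' * (p * R) / c) ^ (p ^ 2 / (2 - p)) * C + 1,
      by positivity, fun ℓ hℓ u ⟨g, hu, eu⟩ => ⟨fun x => g x - WithLp.toLp 2 (0, g₀ x.snd),
        hasWeakGradient_sub hp (hUm _ hℓ) (hUf _) h2 hInf hu, ?_⟩⟩
    obtain ⟨η, hη, h0, h1, hgr⟩ := hcut ℓ hℓ
    obtain ⟨mG, mw, mS⟩ := mL hℓ hu
    have hen := integral_flux_sub_le hp hH (hUm _ hℓ) (hUf _) h2 hf hInf eInf hu eu hη h0 hgr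
      (n := 2 * a) (by positivity)
    have hpoin := poincare_cutoff_mul_sub hp (hUm _ hℓ) (hUf _) h2 hInf hu (hη.pow ha0)
      (fun x => ⟨pow_nonneg (h0 x).1 a, pow_le_one₀ (h0 x).1 (h0 x).2⟩) he hR0.le hR
    have key := integral_pow_mul_le_of_lt_two hp hp2 ha (mD hℓ hu) mG mw (mη hη)
      (fun x => (h0 _).1) (fun x => (h0 _).2) mS (fun x => norm_sub_le _ _)
      (b := (2 * a : ℕ) * (L / ℓ)) (B := p * R) (by positivity) (by positivity) hc hc'.le
      (fun x => by simpa only [mul_assoc] using hmon (g x) (WithLp.toLp 2 (0, g₀ x.snd)))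
      (fun x => by simpa only [mul_assoc] using hlip (g x) (WithLp.toLp 2 (0, g₀ x.snd)))
      hen hpoin
    refine eLpNorm_rpow_le_of_weighted hp hω₁ hω₁c hω₁0 hω₂ hℓ mG
      (F := fun x => (η x.fst ^ a * ‖g x - WithLp.toLp 2 (0, g₀ x.snd)‖) ^ p)
      (integrable_rpow_mul_of_le_one hp0 mG ((mη hη).pow a) (fun x => pow_nonneg (h0 _).1 a)
        fun x => pow_le_one₀ (h0 _).1 (h0 _).2)
      (fun x => Real.rpow_nonneg (mul_nonneg (pow_nonneg (h0 _).1 a) (norm_nonneg _)) p)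
      (fun x hx => by rw [h1 _ hx]; simp) ?_
    refine key.trans ((mul_le_mul_of_nonneg_left (hC ℓ hℓ u g hu eu) (by positivity)).trans ?_)
    have e1 : ((2 * a : ℕ) : ℝ) * (L / ℓ) * c' * (p * R) / c =
        (2 * a * L * c' * (p * R) / c) * ℓ⁻¹ := by push_cast; field_simp
    have e2 : ℓ ^ ((m : ℝ) - p ^ 2 / (2 - p)) = ℓ⁻¹ ^ (p ^ 2 / (2 - p)) * ℓ ^ m := by
      rw [Real.rpow_sub hℓ, Real.inv_rpow hℓ.le, Real.rpow_natCast]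
      field_simp
    rw [e1, e2, Real.mul_rpow (by positivity) (by positivity)]
    have : 0 ≤ ℓ⁻¹ ^ (p ^ 2 / (2 - p)) * ℓ ^ m := by positivity
    linarith
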